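/- Let $k\ge 1$ be an integer and let $\Omega\subset\mathbb R^2$ be a polygonal domain. Let $\mathcal T_h$ be a finite conforming triangulation of $\Omega$: closed nondegenerate triangles whose union is $\overline\Omega$, any two distinct ones meeting in the empty set, a common vertex or a common edge. Let $h_T$ denote the diameter of $T\in\mathcal T_h$ and $\rho_T$ the diameter of its inscribed disc. For $\sigma>0$ the triangulation is called shape regular with parameter $\sigma$ if $h_T\le\sigma\rho_T$ for all $T\in\mathcal T_h$. Let $V_h$ be the space of pairs $v=\{v_0,v_b\}$ such that $v_0|_T\in P_k(T)$ for every $T\in\mathcal T_h$ and $v_b|_e\in P_{k+1}(e)$ for every edge $e$ of $\mathcal T_h$ (one polynomial per edge, also when the edge is shared by two triangles), and let $V_h^0=\{v\in V_h:\ v_b=0\text{ on every edge contained in }\partial\Omega\}$. For $v\in V_h$ the weak gradient $\nabla_w v$ is the piecewise polynomial vector field with $\nabla_w v|_T\in[P_{k+1}(T)]^2$ determined on each $T\in\mathcal T_h$ by $$(\nabla_w v,\mathbf q)_T=-(v_0,\nabla\cdot\mathbf q)_T+\langle v_b,\mathbf q\cdot\mathbf n\rangle_{\partial T}\qquad\text{for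 all }\mathbf q\in[P_{k+1}(T)]^2,$$ where $\mathbf n$ is the outward unit normal on $\partial T$. Put $$|||v|||=\Big(\sum_{T\in\mathcal T_h}\|\nabla_w v\|_T^2\Big)^{1/2},\qquad \|v\|_{1,h}=\Big(\sum_{T\in\mathcal T_h}\big(\|\nabla v_0\|_T^2+h_T^{-1}\|v_0-v_b\|_{\partial T}^2\big)\Big)^{1/2},$$ with $L^2$ norms over $T$ and $\partial T$. Then for every $\sigma>0$ there exist constants $C_1,C_2>0$, depending only on $k$ and $\sigma$ (in particular not on the mesh size $h=\max_T h_T$), such that for every such $\Omega$, every triangulation $\mathcal T_h$ of $\Omega$ that is shape regular with parameter $\sigma$, and every $v\in V_h$, $$C_1\|v\|_{1,h}\le|||v|||\le C_2\|v\|_{1,h}.$$ Moreover, for every triangulation $\mathcal T_h$ of $\Omega$, $|||\cdot|||$ is a norm on $V_h^0$. -/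

import Mathlib

open MeasureTheory Set

noncomputable section

namespace WG

/-- The Euclidean plane `ℝ²`. -/
abbrev Plane := EuclideanSpace ℝ (Fin 2)

/-! ### Polynomial spaces -/

/-- Evaluation of a polynomial in two variables, as a linear map into functions on the plane. -/
def evalLin : MvPolynomial (Fin 2) ℝ →ₗ[ℝ] (Plane → ℝ) where
  toFun p := fun x => MvPolynomial.eval (fun i => x i) p
  map_add' p q := by ext x; simp
  map_smul' c p := by ext x; simp [MvPolynomial.smul_eval]

/-- `P_m`: the polynomial functions of total degree at most `m` on the plane. Since a (nondegenerate)
triangle `T` has interior points, such a function is determined by its restriction to `T`, so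
`PolyFun m` serves as `P_m(T)` for every triangle `T`. -/
def PolyFun (m : ℕ) : Submodule ℝ (Plane → ℝ) :=
  (MvPolynomial.restrictTotalDegree (Fin 2) ℝ m).map evalLin

/-- `P_m(e)`: the functions on the set `e` that are restrictions to `e` of polynomials of degree at
most `m`. On a segment these are exactly the polynomials of degree at most `m` in arc length. -/
def PolyOn (m : ℕ) (e : Set Plane) : Submodule ℝ (e → ℝ) :=
  (PolyFun m).map (LinearMap.funLeft ℝ ℝ (Subtype.val : e → Plane))

/-- `[P_m]²`: vector-valued polynomials. -/
abbrev VecPoly (m : ℕ) := Fin 2 → PolyFun m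

/-- The divergence of a vector-valued polynomial. -/
def divergence {m : ℕ} (q : VecPoly m) (x : Plane) : ℝ :=
  ∑ j, fderiv ℝ (q j : Plane → ℝ) x (EuclideanSpace.single j 1)

/-! ### Triangles -/

/-- The closed triangle with the given vertices. -/
def carrier (T : Affine.Triangle ℝ Plane) : Set Plane := convexHull ℝ (range T.points)

/-- The (closed) edge of a triangle opposite to its `i`-th vertex (indices are taken mod 3). -/
def edge (T : Affine.Triangle ℝ Plane) (i : Fin 3) : Set Plane :=
  segment ℝ (T.points (i + 1)) (T.points (i + 2))

/-- The outward unit normal of a triangle on the edge opposite to its `i`-th vertex: the unit vector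
that points from this vertex to the foot of its altitude. -/
def normal (T : Affine.Triangle ℝ Plane) (i : Fin 3) : Plane :=
  (T.height i)⁻¹ • (T.altitudeFoot i - T.points i)

/-- The arc length measure on an edge (the one-dimensional Hausdorff measure). -/
def arcLength (e : Set Plane) : Measure e := (μH[1] : Measure Plane).comap Subtype.val

/-- `w` is the weak gradient on `T` of the pair with interior value `v₀` and boundary value `vb i` on
the `i`-th edge: `(w, q)_T = -(v₀, ∇ · q)_T + ⟨vb, q · n⟩_{∂T}` for all `q ∈ [P_m]²`. -/
def IsWeakGradient {m : ℕ} (T : Affine.Triangle ℝ Plane) (v₀ : Plane → ℝ)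
    (vb : ∀ i, edge T i → ℝ) (w : VecPoly m) : Prop :=
  ∀ q : VecPoly m,
    ∫ x in carrier T, ∑ j, (w j : Plane → ℝ) x * (q j : Plane → ℝ) x =
      -(∫ x in carrier T, v₀ x * divergence q x) +
        ∑ i, ∫ x : edge T i, vb i x * ∑ j, (q j : Plane → ℝ) x * normal T i j ∂(arcLength (edge T i))

/-! ### Existence and uniqueness of the weak gradient -/

lemma polyFun_analytic {m : ℕ} (f : PolyFun m) : AnalyticOnNhd ℝ (f : Plane → ℝ) univ := by
  obtain ⟨f, p, -, rfl⟩ := f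
  have h1 := AnalyticOnNhd.eval_mvPolynomial (𝕜 := ℝ) p
  have h2 : AnalyticOnNhd ℝ (fun x : Plane => (fun i => x i : Fin 2 → ℝ)) univ :=
    (EuclideanSpace.equiv (Fin 2) ℝ).toContinuousLinearMap.analyticOnNhd _
  exact h1.comp h2 (mapsTo_univ _ _)

lemma polyFun_contDiff {m : ℕ} (f : PolyFun m) : ContDiff ℝ 1 (f : Plane → ℝ) :=
  (polyFun_analytic f).contDiff

lemma polyFun_continuous {m : ℕ} (f : PolyFun m) : Continuous (f : Plane → ℝ) :=
  (polyFun_contDiff f).continuous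

lemma polyFun_eq_zero_of_eqOn {m : ℕ} (f : PolyFun m) {U : Set Plane} (hU : IsOpen U)
    (hne : U.Nonempty) (h : EqOn (f : Plane → ℝ) 0 U) : f = 0 := by
  obtain ⟨x, hx⟩ := hne
  have := (polyFun_analytic f).eq_of_eventuallyEq
    (fun y _ => (analyticAt_const : AnalyticAt ℝ (fun _ : Plane => (0 : ℝ)) y)) (z₀ := x)
    (Filter.eventuallyEq_of_mem (hU.mem_nhds hx) h)
  exact Subtype.ext this

instance (m : ℕ) : FiniteDimensional ℝ (PolyFun m) := by
  unfold PolyFun; infer_instance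

lemma polyOn_continuous {m : ℕ} {e : Set Plane} (f : PolyOn m e) : Continuous (f : e → ℝ) := by
  obtain ⟨f, g, hg, rfl⟩ := f
  exact (polyFun_continuous ⟨g, hg⟩).comp continuous_subtype_val

lemma isCompact_carrier (T : Affine.Triangle ℝ Plane) : IsCompact (carrier T) :=
  (finite_range T.points).isCompact_convexHull (𝕜 := ℝ)

lemma isCompact_edge (T : Affine.Triangle ℝ Plane) (i : Fin 3) : IsCompact (edge T i) := by
  rw [edge, ← convexHull_pair]
  exact (toFinite _).isCompact_convexHull (𝕜 := ℝ)

lemma interior_carrier_nonempty (T : Affine.Triangle ℝ Plane) :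
    (interior (carrier T)).Nonempty := by
  rw [carrier, interior_convexHull_nonempty_iff_affineSpan_eq_top,
    T.independent.affineSpan_eq_top_iff_card_eq_finrank_add_one]
  simp

lemma integrable_edge (T : Affine.Triangle ℝ Plane) (i : Fin 3) {f : edge T i → ℝ}
    (hf : Continuous f) : Integrable f (arcLength (edge T i)) := by
  have hm : MeasurableSet (edge T i) := (isCompact_edge T i).isClosed.measurableSet
  have : CompactSpace (edge T i) := isCompact_iff_compactSpace.1 (isCompact_edge T i)
  have : IsFiniteMeasure (arcLength (edge T i)) := by
    refine ⟨?_⟩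
    rw [arcLength, (MeasurableEmbedding.subtype_coe hm).comap_apply, image_univ,
      Subtype.range_coe, edge, hausdorffMeasure_segment]
    exact edist_lt_top _ _
  exact hf.integrable_of_hasCompactSupport (HasCompactSupport.of_compactSpace f)

lemma integrableOn_carrier (T : Affine.Triangle ℝ Plane) {f : Plane → ℝ} (hf : Continuous f) :
    IntegrableOn f (carrier T) :=
  hf.continuousOn.integrableOn_compact (isCompact_carrier T)

lemma continuous_divergence {m : ℕ} (q : VecPoly m) : Continuous (divergence q) := by
  unfold divergence
  refine continuous_finsetSum _ fun j _ => ?_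
  exact ((polyFun_contDiff (q j)).continuous_fderiv (by simp)).clm_apply continuous_const

lemma divergence_add {m : ℕ} (q r : VecPoly m) (x : Plane) :
    divergence (q + r) x = divergence q x + divergence r x := by
  have hd : ∀ f : PolyFun m, DifferentiableAt ℝ (f : Plane → ℝ) x := fun f =>
    ((polyFun_contDiff f).differentiable (by simp)).differentiableAt
  simp only [divergence, Pi.add_apply, Submodule.coe_add, ← Finset.sum_add_distrib]
  refine Finset.sum_congr rfl fun j _ => ?_
  rw [fderiv_add (hd _) (hd _)]; rfl

lemma divergence_smul {m : ℕ} (c : ℝ) (q : VecPoly m) (x : Plane) :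
    divergence (c • q) x = c * divergence q x := by
  have hd : ∀ f : PolyFun m, DifferentiableAt ℝ (f : Plane → ℝ) x := fun f =>
    ((polyFun_contDiff f).differentiable (by simp)).differentiableAt
  simp only [divergence, Pi.smul_apply, Submodule.coe_smul, Finset.mul_sum]
  refine Finset.sum_congr rfl fun j _ => ?_
  rw [fderiv_const_smul (hd _)]; rfl

/-- The right-hand side of the weak gradient equation, as a linear functional of `q`. -/
def weakRhs (m : ℕ) (T : Affine.Triangle ℝ Plane) (v₀ : Plane → ℝ) (h₀ : Continuous v₀)
    (vb : ∀ i, edge T i → ℝ) (hb : ∀ i, Continuous (vb i)) : VecPoly m →ₗ[ℝ] ℝ where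
  toFun q := -(∫ x in carrier T, v₀ x * divergence q x) +
        ∑ i, ∫ x : edge T i, vb i x * ∑ j, (q j : Plane → ℝ) x * normal T i j ∂(arcLength (edge T i))
  map_add' q r := by
    have e1 : ∫ x in carrier T, v₀ x * divergence (q + r) x =
        (∫ x in carrier T, v₀ x * divergence q x) + ∫ x in carrier T, v₀ x * divergence r x := by
      simp only [divergence_add, mul_add]
      exact integral_add (integrableOn_carrier T (h₀.mul (continuous_divergence q)))
        (integrableOn_carrier T (h₀.mul (continuous_divergence r)))
    have hc : ∀ (s : VecPoly m) i, Continuous fun x : edge T i =>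
        vb i x * ∑ j, (s j : Plane → ℝ) x * normal T i j := fun s i =>
      (hb i).mul (continuous_finsetSum _ fun j _ =>
        ((polyFun_continuous (s j)).comp continuous_subtype_val).mul continuous_const)
    have e2 : ∀ i, ∫ x : edge T i, vb i x * ∑ j, ((q + r) j : Plane → ℝ) x * normal T i j
          ∂(arcLength (edge T i)) =
        (∫ x : edge T i, vb i x * ∑ j, (q j : Plane → ℝ) x * normal T i j
          ∂(arcLength (edge T i))) +
        ∫ x : edge T i, vb i x * ∑ j, (r j : Plane → ℝ) x * normal T i j
          ∂(arcLength (edge T i)) := by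
      intro i
      rw [← integral_add (integrable_edge T i (hc q i)) (integrable_edge T i (hc r i))]
      simp only [Pi.add_apply, Submodule.coe_add, add_mul, Finset.sum_add_distrib, mul_add]
    simp only [e1, e2, Finset.sum_add_distrib]
    ring
  map_smul' c q := by
    have e1 : ∫ x in carrier T, v₀ x * divergence (c • q) x =
        c * ∫ x in carrier T, v₀ x * divergence q x := by
      rw [← integral_const_mul]
      simp only [divergence_smul]
      congr 1; ext x; ring
    have e2 : ∀ i, ∫ x : edge T i, vb i x * ∑ j, ((c • q) j : Plane → ℝ) x * normal T i j
          ∂(arcLength (edge T i)) =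
        c * ∫ x : edge T i, vb i x * ∑ j, (q j : Plane → ℝ) x * normal T i j
          ∂(arcLength (edge T i)) := by
      intro i
      rw [← integral_const_mul]
      congr 1; ext x
      simp only [Pi.smul_apply, Submodule.coe_smul, smul_eq_mul, Finset.mul_sum]
      refine Finset.sum_congr rfl fun j _ => ?_
      ring
    simp only [e1, e2, ← Finset.mul_sum, RingHom.id_apply, smul_eq_mul]
    ring

lemma integrableOn_dot {m : ℕ} (T : Affine.Triangle ℝ Plane) (w q : VecPoly m) :
    IntegrableOn (fun x => ∑ j, (w j : Plane → ℝ) x * (q j : Plane → ℝ) x) (carrier T) :=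
  integrableOn_carrier T (continuous_finsetSum _ fun j _ =>
    (polyFun_continuous (w j)).mul (polyFun_continuous (q j)))

/-- The `L²(T)` inner product on `[P_m]²`. -/
def ipForm (m : ℕ) (T : Affine.Triangle ℝ Plane) : VecPoly m →ₗ[ℝ] VecPoly m →ₗ[ℝ] ℝ :=
  LinearMap.mk₂ ℝ
    (fun w q => ∫ x in carrier T, ∑ j, (w j : Plane → ℝ) x * (q j : Plane → ℝ) x)
    (fun w w' q => by
      rw [← integral_add (integrableOn_dot T w q) (integrableOn_dot T w' q)]
      simp only [Pi.add_apply, Submodule.coe_add, add_mul, Finset.sum_add_distrib])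
    (fun c w q => by
      rw [smul_eq_mul, ← integral_const_mul]
      simp only [Pi.smul_apply, Submodule.coe_smul, smul_eq_mul, Finset.mul_sum, mul_assoc])
    (fun w q q' => by
      rw [← integral_add (integrableOn_dot T w q) (integrableOn_dot T w q')]
      simp only [Pi.add_apply, Submodule.coe_add, mul_add, Finset.sum_add_distrib])
    (fun c w q => by
      rw [smul_eq_mul, ← integral_const_mul]
      simp only [Pi.smul_apply, Submodule.coe_smul, smul_eq_mul, Finset.mul_sum, mul_left_comm])

lemma ipForm_definite {m : ℕ} (T : Affine.Triangle ℝ Plane) (w : VecPoly m)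
    (h : ipForm m T w w = 0) : w = 0 := by
  have hc : Continuous fun x => ∑ j, (w j : Plane → ℝ) x * (w j : Plane → ℝ) x :=
    continuous_finsetSum _ fun j _ => (polyFun_continuous (w j)).mul (polyFun_continuous (w j))
  have h0 : ∫ x in carrier T, ∑ j, (w j : Plane → ℝ) x * (w j : Plane → ℝ) x = 0 := h
  rw [integral_eq_zero_iff_of_nonneg
    (fun x => Finset.sum_nonneg fun j _ => mul_self_nonneg _) (integrableOn_dot T w w)] at h0
  have h1 := ae_restrict_of_ae_restrict_of_subset interior_subset h0
  have h2 := Measure.eqOn_open_of_ae_eq h1 isOpen_interior hc.continuousOn continuousOn_const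
  funext j
  refine polyFun_eq_zero_of_eqOn (w j) isOpen_interior (interior_carrier_nonempty T) fun x hx => ?_
  have h3 := h2 hx
  simp only [Pi.zero_apply] at h3
  rw [Finset.sum_eq_zero_iff_of_nonneg fun j _ => mul_self_nonneg _] at h3
  exact mul_self_eq_zero.1 (h3 j (Finset.mem_univ j))

theorem existsUnique_isWeakGradient (m : ℕ) (T : Affine.Triangle ℝ Plane) (v₀ : Plane → ℝ)
    (h₀ : Continuous v₀) (vb : ∀ i, edge T i → ℝ) (hb : ∀ i, Continuous (vb i)) :
    ∃! w : VecPoly m, IsWeakGradient T v₀ vb w := by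
  have hinj : Function.Injective (ipForm m T) := by
    rw [← LinearMap.ker_eq_bot, LinearMap.ker_eq_bot']
    intro w hw
    exact ipForm_definite T w (by rw [hw]; rfl)
  have hsurj := (LinearMap.injective_iff_surjective_of_finrank_eq_finrank
    (Subspace.dual_finrank_eq (K := ℝ) (V := VecPoly m)).symm).1 hinj
  obtain ⟨w, hw⟩ := hsurj (weakRhs m T v₀ h₀ vb hb)
  refine ⟨w, fun q => LinearMap.congr_fun hw q, fun w' hw' => hinj ?_⟩
  rw [hw]
  exact LinearMap.ext fun q => hw' q

/-! ### Triangulations and weak Galerkin spaces -/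

/-- A (finite, conforming) triangulation of `Ω`: the closed triangles cover the closure of `Ω`, and
two distinct elements meet exactly in the convex hull of their common vertices, that is, in the empty
set, a common vertex or a common edge. (Distinct elements have distinct vertex sets, so that no
triangle is listed twice with its vertices in another order.) -/
structure Triangulation (Ω : Set Plane) where
  elements : Finset (Affine.Triangle ℝ Plane)
  cover : ⋃ T ∈ elements, carrier T = closure Ω
  vertices_injOn : InjOn (fun T : Affine.Triangle ℝ Plane => range T.points) elements
  inter_eq : ∀ T ∈ elements, ∀ T' ∈ elements, T ≠ T' →
    carrier T ∩ carrier T' = convexHull ℝ (range T.points ∩ range T'.points)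

namespace Triangulation

variable {Ω : Set Plane}

/-- The set of all edges of the triangulation. An edge shared by two triangles is one member. -/
def edges (𝒯 : Triangulation Ω) : Set (Set Plane) := {e | ∃ T ∈ 𝒯.elements, ∃ i, e = edge T i}

/-- The `i`-th edge of an element, as an edge of the triangulation. -/
def edgeOf (𝒯 : Triangulation Ω) (T : 𝒯.elements) (i : Fin 3) : 𝒯.edges :=
  ⟨edge T i, T, T.2, i, rfl⟩

/-- Shape regularity with parameter `σ`: every element `T` contains a disc of some diameter `ρ > 0`
with `h_T ≤ σ ρ`, that is, `h_T / ρ_T ≤ σ` with `ρ_T` the diameter of the inscribed disc. -/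
def ShapeRegular (𝒯 : Triangulation Ω) (σ : ℝ) : Prop :=
  ∀ T ∈ 𝒯.elements, ∃ (c : Plane) (ρ : ℝ), 0 < ρ ∧ Metric.closedBall c (ρ / 2) ⊆ carrier T ∧
    Metric.diam (carrier T) ≤ σ * ρ

/-- The weak Galerkin space `V_h` of pairs `v = {v₀, v_b}`: `v₀` is in `P_k(T)` on each element `T`,
and `v_b` is in `P_{k+1}(e)` on each edge `e` (with one value on each edge). -/
abbrev Vh (𝒯 : Triangulation Ω) (k : ℕ) : Type :=
  (𝒯.elements → PolyFun k) × (∀ e : 𝒯.edges, PolyOn (k + 1) (e : Set Plane))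

/-- The subspace `V_h⁰` of the pairs with `v_b = 0` on `∂Ω`. -/
def Vh0 (𝒯 : Triangulation Ω) (k : ℕ) : Submodule ℝ (𝒯.Vh k) where
  carrier := {v | ∀ e : 𝒯.edges, (e : Set Plane) ⊆ frontier Ω → v.2 e = 0}
  add_mem' hv hw e he := by simp [hv e he, hw e he]
  zero_mem' e _ := rfl
  smul_mem' c v hv e he := by simp [hv e he]

variable {𝒯 : Triangulation Ω} {k : ℕ}

/-- The value of `v₀` on the element `T`. -/
def interiorPart (v : 𝒯.Vh k) (T : 𝒯.elements) : Plane → ℝ := v.1 T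

/-- The value of `v_b` on the `i`-th edge of the element `T`. -/
def boundaryPart (v : 𝒯.Vh k) (T : 𝒯.elements) (i : Fin 3) :
    edge (T : Affine.Triangle ℝ Plane) i → ℝ := (v.2 (𝒯.edgeOf T i)).1

/-- The weak gradient `∇_w v ∈ [P_{k+1}(T)]²` on an element `T`: the unique solution of its defining
equation. -/
def weakGrad (v : 𝒯.Vh k) (T : 𝒯.elements) : VecPoly (k + 1) :=
  (existsUnique_isWeakGradient (k + 1) T (interiorPart v T) (polyFun_continuous (v.1 T))
    (boundaryPart v T) (fun i => (polyOn_continuous (v.2 (𝒯.edgeOf T i))))).choose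

lemma isWeakGradient_weakGrad (v : 𝒯.Vh k) (T : 𝒯.elements) :
    IsWeakGradient (T : Affine.Triangle ℝ Plane) (interiorPart v T) (boundaryPart v T)
      (weakGrad v T) :=
  (existsUnique_isWeakGradient (k + 1) T (interiorPart v T) (polyFun_continuous (v.1 T))
    (boundaryPart v T) (fun i => (polyOn_continuous (v.2 (𝒯.edgeOf T i))))).choose_spec.1

/-- The energy seminorm `|||v||| = (∑_T ‖∇_w v‖²_T)^{1/2}`. -/
def energyNorm (v : 𝒯.Vh k) : ℝ :=
  √(∑ T : 𝒯.elements, ∫ x in carrier (T : Affine.Triangle ℝ Plane),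
    ∑ j, (weakGrad v T j : Plane → ℝ) x ^ 2)

/-- The discrete seminorm
`‖v‖_{1,h} = (∑_T (‖∇v₀‖²_T + h_T⁻¹ ‖v₀ - v_b‖²_{∂T}))^{1/2}`. -/
def discreteH1Norm (v : 𝒯.Vh k) : ℝ :=
  √(∑ T : 𝒯.elements,
    ((∫ x in carrier (T : Affine.Triangle ℝ Plane), ‖gradient (interiorPart v T) x‖ ^ 2) +
      (Metric.diam (carrier (T : Affine.Triangle ℝ Plane)))⁻¹ *
        ∑ i, ∫ x : edge (T : Affine.Triangle ℝ Plane) i,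
          (interiorPart v T x - boundaryPart v T i x) ^ 2 ∂(arcLength (edge T i))))

end Triangulation

end WG

end

noncomputable section

namespace WG

/-! ### Polynomial functions -/

/-! Integrating `(v₀, ∇·q)` by parts on one triangle gives `(∇_w v, q) = (∇v₀, q) - ⟨v₀ - v_b, q·n⟩`
for all `q` in `[P_{k+1}]²`. The weak gradient is thus a linear function of `∇v₀` and the jumps, and
the lower bound says that this function is injective, quantitatively.

Injectivity holds even when `∇v₀` is replaced by any field `g` in `[P_{k-1}]²` and the jumps by
arbitrary edge polynomials `μ` of degree at most `k+1` (`refSpace_data_eq_zero`). Testing with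
components of `g` times quadratic weights that kill the normal trace gives `g = 0`; testing with
fields whose normal trace is `μ` on one edge and zero on the other two gives `μ = 0`. Positive
definite forms on a finite-dimensional space are comparable (`exists_form_le`), which yields
`exists_reference_equivalence` on the standard triangle with a constant depending only on `k`.

For a general triangle, weak gradients are pulled back covariantly and test fields pushed forward
contravariantly. Every term of the equation then acquires the same factor `|jac T|`, so the
pulled-back problem does not depend on `T` (`weakGradient_reference`, `reference_problem`). The
norms are distorted only by powers of `h_T² / |jac T|`, which shape regularity bounds
(`diam_sq_le_of_shapeRegular`). In the plane the Dirichlet integral and the `h_T⁻¹`-weighted jump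
integral are both scale invariant, so no power of `h` remains (`exists_local_equivalence`). Summing
over the elements gives the two-sided bound.

For the norm property, a vanishing weak gradient on `T` forces `v₀` and `v_b` to equal one constant
`c T` there (`weakGradient_kernel`). If some constant were nonzero, the union of the triangles
carrying it would be open and closed in the plane minus the finitely many vertices, because such a
triangle has no edge in `∂Ω` and each of its edges is shared with a neighbour (`exists_neighbour`).
This compact union would be the whole plane (`local_constant_eq_zero`). -/

lemma mem_polyFun_iff {m : ℕ} {f : Plane → ℝ} :
    f ∈ PolyFun m ↔ ∃ p : MvPolynomial (Fin 2) ℝ, p.totalDegree ≤ m ∧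
      ∀ x, f x = MvPolynomial.eval (fun i => x i) p := by
  simp only [PolyFun, Submodule.mem_map, MvPolynomial.mem_restrictTotalDegree]
  refine exists_congr fun p => and_congr_right fun _ => ?_
  rw [funext_iff]
  exact forall_congr' fun x => eq_comm

lemma polyFun_mono {m n : ℕ} (h : m ≤ n) : PolyFun m ≤ PolyFun n := by
  intro f hf
  obtain ⟨p, hp, hf⟩ := mem_polyFun_iff.1 hf
  exact mem_polyFun_iff.2 ⟨p, hp.trans h, hf⟩

lemma const_mem_polyFun (m : ℕ) (c : ℝ) : (fun _ => c) ∈ PolyFun m :=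
  mem_polyFun_iff.2 ⟨MvPolynomial.C c, by simp, by simp⟩

lemma coord_mem_polyFun (i : Fin 2) : (fun x : Plane => x i) ∈ PolyFun 1 :=
  mem_polyFun_iff.2 ⟨MvPolynomial.X i, by simp, by simp⟩

lemma mul_mem_polyFun {m n : ℕ} {f g : Plane → ℝ} (hf : f ∈ PolyFun m) (hg : g ∈ PolyFun n) :
    (fun x => f x * g x) ∈ PolyFun (m + n) := by
  obtain ⟨p, hp, hf⟩ := mem_polyFun_iff.1 hf
  obtain ⟨q, hq, hg⟩ := mem_polyFun_iff.1 hg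
  exact mem_polyFun_iff.2 ⟨p * q, (MvPolynomial.totalDegree_mul p q).trans (by lia),
    fun x => by simp [hf, hg]⟩

lemma pow_mem_polyFun {f : Plane → ℝ} (hf : f ∈ PolyFun 1) (n : ℕ) :
    (fun x => f x ^ n) ∈ PolyFun n := by
  induction n with
  | zero => simpa using const_mem_polyFun 0 1
  | succ n ih => simpa only [pow_succ] using mul_mem_polyFun ih hf

lemma add_mem_polyFun {m : ℕ} {f g : Plane → ℝ} (hf : f ∈ PolyFun m) (hg : g ∈ PolyFun m) :
    (fun x => f x + g x) ∈ PolyFun m := (PolyFun m).add_mem hf hg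

lemma sub_mem_polyFun {m : ℕ} {f g : Plane → ℝ} (hf : f ∈ PolyFun m) (hg : g ∈ PolyFun m) :
    (fun x => f x - g x) ∈ PolyFun m := (PolyFun m).sub_mem hf hg

lemma const_mul_mem_polyFun {m : ℕ} {f : Plane → ℝ} (c : ℝ) (hf : f ∈ PolyFun m) :
    (fun x => c * f x) ∈ PolyFun m := (PolyFun m).smul_mem c hf

/-- Explicit monomials reduce affine substitution and differentiation, with their degree bounds, to
one monomial at a time. -/
lemma exists_monomial_sum {m : ℕ} {f : Plane → ℝ} (hf : f ∈ PolyFun m) :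
    ∃ (s : Finset (ℕ × ℕ)) (c : ℕ × ℕ → ℝ), (∀ d ∈ s, d.1 + d.2 ≤ m) ∧
      ∀ x, f x = ∑ d ∈ s, c d * (x 0 ^ d.1 * x 1 ^ d.2) := by
  obtain ⟨p, hp, hf⟩ := mem_polyFun_iff.1 hf
  have hinj : Set.InjOn (fun d : Fin 2 →₀ ℕ => (d 0, d 1)) p.support := by
    intro d _ d' _ h
    ext i
    simp only [Prod.mk.injEq] at h
    fin_cases i
    exacts [h.1, h.2]
  refine ⟨p.support.image fun d => (d 0, d 1),
    fun d => p.coeff (Finsupp.single 0 d.1 + Finsupp.single 1 d.2), ?_, fun x => ?_⟩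
  · intro d hd
    obtain ⟨e, he, rfl⟩ := Finset.mem_image.1 hd
    have := MvPolynomial.le_totalDegree he
    rw [Finsupp.sum_fintype _ _ (by simp)] at this
    simpa using this.trans hp
  · rw [hf, MvPolynomial.eval_eq', Finset.sum_image hinj]
    refine Finset.sum_congr rfl fun d _ => ?_
    have : Finsupp.single 0 (d 0) + Finsupp.single 1 (d 1) = d := by
      ext i; fin_cases i <;> simp
    simp [this]

lemma comp_mem_polyFun {m : ℕ} {f : Plane → ℝ} (hf : f ∈ PolyFun m) {G : Plane → Plane}
    (hG : ∀ j, (fun x => G x j) ∈ PolyFun 1) : (fun x => f (G x)) ∈ PolyFun m := by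
  obtain ⟨s, c, hs, hf⟩ := exists_monomial_sum hf
  have : (fun x => f (G x)) = ∑ d ∈ s, fun x => c d * (G x 0 ^ d.1 * G x 1 ^ d.2) := by
    ext x; simp [hf]
  rw [this]
  exact Submodule.sum_mem _ fun d hd => const_mul_mem_polyFun _ (polyFun_mono (hs d hd)
    (mul_mem_polyFun (pow_mem_polyFun (hG 0) _) (pow_mem_polyFun (hG 1) _)))

lemma fderiv_mem_polyFun {m : ℕ} {f : Plane → ℝ} (hf : f ∈ PolyFun m) (v : Plane) :
    (fun x => fderiv ℝ f x v) ∈ PolyFun (m - 1) := by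
  obtain ⟨s, c, hs, hf⟩ := exists_monomial_sum hf
  have hd : ∀ x, HasFDerivAt f (∑ d ∈ s, c d • (x 0 ^ d.1 • (((d.2 : ℝ) * x 1 ^ (d.2 - 1)) •
      (EuclideanSpace.proj 1 : Plane →L[ℝ] ℝ)) +
      x 1 ^ d.2 • (((d.1 : ℝ) * x 0 ^ (d.1 - 1)) •
      (EuclideanSpace.proj 0 : Plane →L[ℝ] ℝ)))) x := by
    intro x
    rw [funext hf]
    refine HasFDerivAt.fun_sum fun d _ => HasFDerivAt.const_mul ?_ _
    have h := fun i n => ((EuclideanSpace.proj i : Plane →L[ℝ] ℝ).hasFDerivAt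
      (x := x)).pow n
    simpa using (h 0 d.1).fun_mul (h 1 d.2)
  have : (fun x => fderiv ℝ f x v) = ∑ d ∈ s, fun x : Plane =>
      c d * (x 0 ^ d.1 * (d.2 * x 1 ^ (d.2 - 1) * v 1) +
        x 1 ^ d.2 * (d.1 * x 0 ^ (d.1 - 1) * v 0)) := by
    ext x
    simp [(hd x).fderiv, mul_add]
  rw [this]
  refine Submodule.sum_mem _ fun d hd => const_mul_mem_polyFun _ (add_mem_polyFun ?_ ?_)
  -- Exponent zero is treated apart: the truncated `d.2 - 1` would then give no drop in degree, but
  -- the factor `d.2` kills the term.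
  · rcases Nat.eq_zero_or_pos d.2 with h | h
    · simpa [h] using const_mem_polyFun (m - 1) 0
    · have := mul_mem_polyFun (pow_mem_polyFun (coord_mem_polyFun 0) d.1)
        (pow_mem_polyFun (coord_mem_polyFun 1) (d.2 - 1))
      have := const_mul_mem_polyFun (d.2 * v 1)
        (polyFun_mono (n := m - 1) (by have := hs d hd; lia) this)
      convert this using 2
      ring
  · rcases Nat.eq_zero_or_pos d.1 with h | h
    · simpa [h] using const_mem_polyFun (m - 1) 0
    · have := mul_mem_polyFun (pow_mem_polyFun (coord_mem_polyFun 1) d.2)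
        (pow_mem_polyFun (coord_mem_polyFun 0) (d.1 - 1))
      have := const_mul_mem_polyFun (d.1 * v 0)
        (polyFun_mono (n := m - 1) (by have := hs d hd; lia) this)
      convert this using 2
      ring

/-- The polynomial functions of degree at most `m` in one real variable. -/
def LinePoly (m : ℕ) : Submodule ℝ (ℝ → ℝ) :=
  (Polynomial.degreeLT ℝ (m + 1)).map
    ({ toFun := fun p s => p.eval s
       map_add' := fun p q => by ext; simp
       map_smul' := fun c p => by ext; simp } : Polynomial ℝ →ₗ[ℝ] (ℝ → ℝ))

lemma mem_linePoly_iff {m : ℕ} {f : ℝ → ℝ} :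
    f ∈ LinePoly m ↔ ∃ p : Polynomial ℝ, p.natDegree ≤ m ∧ ∀ s, f s = p.eval s := by
  simp only [LinePoly, Submodule.mem_map, Polynomial.mem_degreeLT,
    Polynomial.degree_lt_iff_coeff_zero, Polynomial.natDegree_le_iff_coeff_eq_zero,
    Nat.succ_le_iff]
  refine exists_congr fun p => and_congr_right fun _ => ?_
  rw [funext_iff]
  exact forall_congr' fun x => eq_comm

instance (m : ℕ) : FiniteDimensional ℝ (LinePoly m) := by
  have : FiniteDimensional ℝ (Polynomial.degreeLT ℝ (m + 1)) :=
    (Polynomial.degreeLTEquiv ℝ (m + 1)).symm.finiteDimensional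
  unfold LinePoly; infer_instance

lemma linePoly_continuous {m : ℕ} {f : ℝ → ℝ} (hf : f ∈ LinePoly m) : Continuous f := by
  obtain ⟨p, -, hf⟩ := mem_linePoly_iff.1 hf
  rw [funext hf]
  exact p.continuous

lemma linePoly_eq_zero_of_eqOn {m : ℕ} {f : ℝ → ℝ} (hf : f ∈ LinePoly m)
    (h : EqOn f 0 (Icc 0 1)) : f = 0 := by
  obtain ⟨p, -, hf⟩ := mem_linePoly_iff.1 hf
  have : p = 0 := Polynomial.eq_zero_of_infinite_isRoot p
    ((Icc_infinite (zero_lt_one (α := ℝ))).mono fun s hs => by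
      simpa [← hf] using h hs)
  ext s
  simp [hf, this]

/-- From `p = p(0) + s · divX p` one gets `(1 - s) p(0) + s (divX p + p(0))`. Each summand carries
the barycentric coordinate of one endpoint as a factor, which is what allows it to be extended from
an edge to a field on the triangle. -/
lemma linePoly_decomposition {k : ℕ} {μ : ℝ → ℝ} (hμ : μ ∈ LinePoly (k + 1)) :
    ∃ (c : ℝ) (r : Polynomial ℝ), r.natDegree ≤ k ∧ ∀ s, μ s = (1 - s) * c + s * r.eval s := by
  obtain ⟨p, hp, hμ⟩ := mem_linePoly_iff.1 hμ
  refine ⟨p.coeff 0, p.divX + Polynomial.C (p.coeff 0), ?_, fun s => ?_⟩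
  · refine (Polynomial.natDegree_add_le _ _).trans ?_
    simp [Polynomial.natDegree_divX_eq_natDegree_tsub_one]
    lia
  · have := congrArg (Polynomial.eval s) (Polynomial.divX_mul_X_add p)
    simp at this
    rw [hμ]
    simp
    linarith

lemma polynomial_comp_mem_polyFun {k : ℕ} {r : Polynomial ℝ} (hr : r.natDegree ≤ k)
    {u : Plane → ℝ} (hu : u ∈ PolyFun 1) : (fun x => r.eval (u x)) ∈ PolyFun k := by
  have : (fun x => r.eval (u x)) =
      ∑ i ∈ Finset.range (r.natDegree + 1), fun x => r.coeff i * u x ^ i := by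
    ext x; simp [Polynomial.eval_eq_sum_range]
  rw [this]
  exact Submodule.sum_mem _ fun i hi => const_mul_mem_polyFun _
    (polyFun_mono (by have := Finset.mem_range.1 hi; lia) (pow_mem_polyFun hu i))

lemma comp_line_mem_linePoly {m : ℕ} {f : Plane → ℝ} (hf : f ∈ PolyFun m) (γ : ℝ → Plane)
    (c d : Fin 2 → ℝ) (hγ : ∀ s j, γ s j = c j + s * d j) : (fun s => f (γ s)) ∈ LinePoly m := by
  obtain ⟨p, hp, hf⟩ := mem_polyFun_iff.1 hf
  refine mem_linePoly_iff.2 ⟨MvPolynomial.aeval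
    (fun j => Polynomial.C (c j) + Polynomial.X * Polynomial.C (d j)) p, ?_, fun s => ?_⟩
  · have := MvPolynomial.aeval_natDegree_le (n := 1) p hp
      (fun j => Polynomial.C (c j) + Polynomial.X * Polynomial.C (d j)) fun j => by compute_degree
    simpa using this
  · rw [hf]
    simp only [hγ]
    rw [← Polynomial.coe_evalRingHom, MvPolynomial.aeval_def, MvPolynomial.hom_eval₂]
    simp [MvPolynomial.eval₂_eq', MvPolynomial.eval_eq', mul_comm s]

/-! ### The affine chart of a triangle -/

/-- The standard triangle with vertices `(0, 0)`, `(1, 0)`, `(0, 1)`. -/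
def refTriangle : Set Plane := {x | 0 ≤ x 0 ∧ 0 ≤ x 1 ∧ x 0 + x 1 ≤ 1}

/-- The two-dimensional cross product. -/
def cross (u v : Plane) : ℝ := u 0 * v 1 - u 1 * v 0

/-- The side of a triangle from the vertex `0` to the vertex `j + 1`. -/
def side (T : Affine.Triangle ℝ Plane) (j : Fin 2) : Plane := T.points j.succ - T.points 0

/-- The signed Jacobian of the chart, twice the signed area of the triangle. -/
def jac (T : Affine.Triangle ℝ Plane) : ℝ := cross (side T 0) (side T 1)

/-- The affine map that takes the standard triangle to `T`. -/
def chart (T : Affine.Triangle ℝ Plane) (x : Plane) : Plane :=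
  T.points 0 + (x 0 • side T 0 + x 1 • side T 1)

/-- The inverse of the chart. -/
def chartInv (T : Affine.Triangle ℝ Plane) (z : Plane) : Plane :=
  !₂[cross (z - T.points 0) (side T 1) / jac T, cross (side T 0) (z - T.points 0) / jac T]

lemma jac_ne_zero (T : Affine.Triangle ℝ Plane) : jac T ≠ 0 := by
  intro hD
  have key : ∀ α β : ℝ, α • side T 0 + β • side T 1 = 0 → α = 0 ∧ β = 0 := by
    intro α β h
    have hT := (affineIndependent_iff (k := ℝ)).1 T.independent Finset.univ
      ![-α - β, α, β] (by simp [Fin.sum_univ_three]; ring)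
      (by
        rw [← h]
        simp [Fin.sum_univ_three, side]
        module)
    exact ⟨hT 1 (Finset.mem_univ _), hT 2 (Finset.mem_univ _)⟩
  unfold jac cross at hD
  -- A zero determinant makes these linear relations between the two sides true; independence makes
  -- them trivial, so both entries of `side T 0` vanish, which contradicts independence again.
  have h1 := key (side T 1 1) (-side T 0 1) (by
    ext i; fin_cases i <;> simp <;> linarith)
  have h2 := key (side T 1 0) (-side T 0 0) (by
    ext i; fin_cases i <;> simp <;> linarith)
  have h3 := key 1 0 (by
    ext i; fin_cases i
    · simpa using h2.2
    · simpa using h1.2)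
  exact one_ne_zero h3.1

lemma chart_apply (T : Affine.Triangle ℝ Plane) (x : Plane) (i : Fin 2) :
    chart T x i = T.points 0 i + (x 0 * side T 0 i + x 1 * side T 1 i) := by
  simp [chart]

lemma chart_chartInv (T : Affine.Triangle ℝ Plane) (z : Plane) : chart T (chartInv T z) = z := by
  have h := jac_ne_zero T
  ext i
  rw [chart_apply]
  simp only [chartInv, PiLp.toLp_apply, Matrix.cons_val_zero, Matrix.cons_val_one]
  field_simp
  simp only [jac, cross]
  fin_cases i <;> simp <;> ring

lemma chartInv_chart (T : Affine.Triangle ℝ Plane) (x : Plane) : chartInv T (chart T x) = x := by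
  have h := jac_ne_zero T
  ext i
  simp only [chartInv, PiLp.toLp_apply]
  fin_cases i
  · simp
    rw [div_eq_iff h]
    simp [jac, cross, chart_apply]
    ring
  · simp
    rw [div_eq_iff h]
    simp [jac, cross, chart_apply]
    ring

lemma chart_injective (T : Affine.Triangle ℝ Plane) : Function.Injective (chart T) :=
  Function.LeftInverse.injective (chartInv_chart T)

lemma chart_mem_polyFun (T : Affine.Triangle ℝ Plane) (j : Fin 2) :
    (fun x => chart T x j) ∈ PolyFun 1 := by
  simp only [chart_apply]
  refine add_mem_polyFun (const_mem_polyFun _ _) (add_mem_polyFun ?_ ?_)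
  · simpa only [mul_comm] using const_mul_mem_polyFun (side T 0 j) (coord_mem_polyFun 0)
  · simpa only [mul_comm] using const_mul_mem_polyFun (side T 1 j) (coord_mem_polyFun 1)

lemma chartInv_mem_polyFun (T : Affine.Triangle ℝ Plane) (j : Fin 2) :
    (fun x => chartInv T x j) ∈ PolyFun 1 := by
  have h : ∀ a b c : ℝ, (fun x : Plane => a * x 0 + b * x 1 + c) ∈ PolyFun 1 := fun a b c =>
    add_mem_polyFun (add_mem_polyFun (const_mul_mem_polyFun _ (coord_mem_polyFun 0))
      (const_mul_mem_polyFun _ (coord_mem_polyFun 1))) (const_mem_polyFun _ _)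
  fin_cases j
  · convert h (side T 1 1 / jac T) (-side T 1 0 / jac T)
      ((T.points 0 1 * side T 1 0 - T.points 0 0 * side T 1 1) / jac T) using 2
    simp [chartInv, cross]
    ring
  · convert h (-side T 0 1 / jac T) (side T 0 0 / jac T)
      ((T.points 0 0 * side T 0 1 - T.points 0 1 * side T 0 0) / jac T) using 2
    simp [chartInv, cross]
    ring

lemma convex_refTriangle : Convex ℝ refTriangle := by
  intro x hx y hy a b ha hb hab
  obtain ⟨h1, h2, h3⟩ := hx
  obtain ⟨h4, h5, h6⟩ := hy
  refine ⟨?_, ?_, ?_⟩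
  · simp; positivity
  · simp; positivity
  · simp; nlinarith

lemma mem_carrier_of_barycentric (T : Affine.Triangle ℝ Plane) {z : Plane}
    (hz : chartInv T z ∈ refTriangle) : z ∈ carrier T := by
  obtain ⟨h1, h2, h3⟩ := hz
  rw [← chart_chartInv T z]
  have := (convex_convexHull ℝ (range T.points)).sum_mem (t := Finset.univ)
    (w := ![1 - chartInv T z 0 - chartInv T z 1, chartInv T z 0, chartInv T z 1])
    (z := T.points) (by
      intro i _
      fin_cases i <;> simp <;> linarith) (by simp [Fin.sum_univ_three]; ring)
    (fun i _ => subset_convexHull ℝ _ (mem_range_self i))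
  rw [carrier]
  convert this using 2
  simp [Fin.sum_univ_three, chart, side]
  module

lemma chart_lineMap (T : Affine.Triangle ℝ Plane) (x y : Plane) (a b : ℝ) (h : a + b = 1) :
    chart T (a • x + b • y) = a • chart T x + b • chart T y := by
  obtain rfl : b = 1 - a := by linarith
  simp only [chart, PiLp.add_apply, PiLp.smul_apply, smul_eq_mul]
  module

lemma carrier_eq_image (T : Affine.Triangle ℝ Plane) : carrier T = chart T '' refTriangle := by
  apply Subset.antisymm
  · refine convexHull_min ?_ ?_
    · rintro _ ⟨i, rfl⟩
      fin_cases i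
      · exact ⟨!₂[0, 0], by simp [refTriangle], by simp [chart]⟩
      · exact ⟨!₂[1, 0], by simp [refTriangle], by simp [chart, side]⟩
      · exact ⟨!₂[0, 1], by simp [refTriangle], by simp [chart, side]⟩
    · rintro _ ⟨x, hx, rfl⟩ _ ⟨y, hy, rfl⟩ a b ha hb hab
      exact ⟨a • x + b • y, convex_refTriangle hx hy ha hb hab, chart_lineMap T x y a b hab⟩
  · rintro _ ⟨x, hx, rfl⟩
    exact mem_carrier_of_barycentric T (by rwa [chartInv_chart])

lemma mem_carrier_iff (T : Affine.Triangle ℝ Plane) {z : Plane} :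
    z ∈ carrier T ↔ chartInv T z ∈ refTriangle := by
  refine ⟨fun h => ?_, mem_carrier_of_barycentric T⟩
  rw [carrier_eq_image] at h
  obtain ⟨x, hx, rfl⟩ := h
  rwa [chartInv_chart]

lemma isClosed_refTriangle : IsClosed refTriangle := by
  have h : refTriangle = {x : Plane | 0 ≤ x 0} ∩ ({x | 0 ≤ x 1} ∩ {x | x 0 + x 1 ≤ 1}) := rfl
  rw [h]
  refine (isClosed_le ?_ ?_).inter ((isClosed_le ?_ ?_).inter (isClosed_le ?_ ?_)) <;> fun_prop

/-- The linear part of the chart. -/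
def chartLin (T : Affine.Triangle ℝ Plane) : Plane →L[ℝ] Plane :=
  ((EuclideanSpace.proj 0 : Plane →L[ℝ] ℝ).smulRight (side T 0)) +
    ((EuclideanSpace.proj 1 : Plane →L[ℝ] ℝ).smulRight (side T 1))

lemma hasFDerivAt_chart (T : Affine.Triangle ℝ Plane) (x : Plane) :
    HasFDerivAt (chart T) (chartLin T) x := by
  have h : chart T = fun y => T.points 0 + chartLin T y := by
    ext y i; simp [chart, chartLin]
  rw [h]
  exact (chartLin T).hasFDerivAt.const_add _

lemma continuous_chart (T : Affine.Triangle ℝ Plane) : Continuous (chart T) :=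
  continuous_iff_continuousAt.2 fun x => (hasFDerivAt_chart T x).continuousAt

lemma det_chartLin (T : Affine.Triangle ℝ Plane) : (chartLin T).det = jac T := by
  have : (chartLin T).det = LinearMap.det (chartLin T : Plane →ₗ[ℝ] Plane) := rfl
  rw [this, ← LinearMap.det_toMatrix (EuclideanSpace.basisFun (Fin 2) ℝ).toBasis,
    Matrix.det_fin_two]
  simp [LinearMap.toMatrix_apply, chartLin, jac, cross]
  ring

lemma setIntegral_carrier (T : Affine.Triangle ℝ Plane) (f : Plane → ℝ) :
    ∫ x in carrier T, f x = |jac T| * ∫ x in refTriangle, f (chart T x) := by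
  rw [carrier_eq_image, integral_image_eq_integral_abs_det_fderiv_smul volume
    isClosed_refTriangle.measurableSet (fun x _ => (hasFDerivAt_chart T x).hasFDerivWithinAt)
    (chart_injective T).injOn]
  simp [det_chartLin, integral_const_mul]

/-! ### Edges and normals -/

/-- The unit-speed parametrization is an isometric embedding of the line, so it carries Lebesgue
measure to one-dimensional Hausdorff measure on its range; rescaling to `[0, 1]` produces the factor
`dist p q`. -/
lemma setIntegral_segment {p q : Plane} (hpq : p ≠ q) (f : Plane → ℝ) :
    ∫ x : segment ℝ p q, f x ∂(arcLength (segment ℝ p q)) =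
      dist p q * ∫ s in (0 : ℝ)..1, f (AffineMap.lineMap p q s) := by
  have hm : MeasurableSet (segment ℝ p q) := by
    rw [← convexHull_pair]
    exact ((toFinite _).isCompact_convexHull (𝕜 := ℝ)).isClosed.measurableSet
  have hd : 0 < dist p q := dist_pos.2 hpq
  have hn : ‖q - p‖ = dist p q := by rw [dist_comm, dist_eq_norm]
  set φ : ℝ → Plane := fun r => p + r • ((dist p q)⁻¹ • (q - p)) with hφ
  have hiso : Isometry φ := by
    refine Isometry.of_dist_eq fun r r' => ?_
    rw [hφ, dist_eq_norm]
    have : p + r • ((dist p q)⁻¹ • (q - p)) - (p + r' • ((dist p q)⁻¹ • (q - p))) =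
      (r - r') • ((dist p q)⁻¹ • (q - p)) := by module
    simp only [this, norm_smul, hn, Real.dist_eq, norm_inv, Real.norm_of_nonneg hd.le]
    rw [inv_mul_cancel₀ hd.ne', mul_one, Real.norm_eq_abs]
  have himage : segment ℝ p q = φ '' Icc 0 (dist p q) := by
    rw [segment_eq_image']
    ext z
    constructor
    · rintro ⟨θ, hθ, rfl⟩
      refine ⟨θ * dist p q, ⟨mul_nonneg hθ.1 hd.le, by nlinarith [hθ.2]⟩, ?_⟩
      simp only [hφ, smul_smul, mul_assoc, mul_inv_cancel₀ hd.ne', mul_one]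
    · rintro ⟨r, hr, rfl⟩
      refine ⟨r / dist p q, ⟨div_nonneg hr.1 hd.le, (div_le_one hd).2 hr.2⟩, ?_⟩
      simp only [hφ, smul_smul, div_eq_mul_inv]
  have hmap : Measure.map φ (volume : Measure ℝ) = (μH[1] : Measure Plane).restrict (range φ) := by
    rw [← hausdorffMeasure_real]
    exact hiso.map_hausdorffMeasure (Or.inl zero_le_one)
  have hemb : MeasurableEmbedding φ := hiso.isClosedEmbedding.measurableEmbedding
  rw [arcLength, integral_subtype_comap hm]
  have h1 : (μH[1] : Measure Plane).restrict (segment ℝ p q) =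
      (Measure.map φ volume).restrict (φ '' Icc 0 (dist p q)) := by
    rw [hmap, Measure.restrict_restrict (himage ▸ hm), himage,
      inter_eq_self_of_subset_left (image_subset_range _ _)]
  rw [h1, hemb.setIntegral_map, hiso.injective.preimage_image,
    integral_Icc_eq_integral_Ioc, ← intervalIntegral.integral_of_le hd.le]
  have h2 := intervalIntegral.integral_comp_mul_right (a := 0) (b := 1) (fun r => f (φ r)) hd.ne'
  have h3 : ∀ s, φ (s * dist p q) = AffineMap.lineMap p q s := by
    intro s
    simp only [hφ, smul_smul, mul_assoc, mul_inv_cancel₀ hd.ne', mul_one]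
    rw [AffineMap.lineMap_apply, vsub_eq_sub, vadd_eq_add, add_comm]
  simp only [h3, zero_mul, one_mul, smul_eq_mul] at h2
  rw [h2, mul_inv_cancel_left₀ hd.ne']

/-- The flux of a constant field with components `u` through the `i`-th edge of the standard
triangle. -/
def refFlux (i : Fin 3) (u : Fin 2 → ℝ) : ℝ := ![u 0 + u 1, -u 0, -u 1] i

lemma real_inner_plane (u v : Plane) : inner ℝ u v = ∑ j, u j * v j := by
  simp [PiLp.inner_apply, mul_comm]

lemma inner_normal (T : Affine.Triangle ℝ Plane) {i j : Fin 3} (h : i ≠ j) :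
    ∑ l, (T.points j - T.points i) l * normal T i l = T.height i := by
  have h1 := T.inner_vsub_vsub_altitudeFoot_eq_height_sq h
  have hp := T.height_pos i
  rw [← real_inner_plane, normal, inner_smul_right, ← neg_sub (T.points i), inner_neg_left,
    ← neg_sub (T.points i), inner_neg_right, neg_neg]
  simp only [vsub_eq_sub] at h1
  rw [h1]
  field_simp

lemma norm_normal (T : Affine.Triangle ℝ Plane) (i : Fin 3) : ∑ l, normal T i l ^ 2 = 1 := by
  have hp := T.height_pos i
  have h1 : ‖T.altitudeFoot i - T.points i‖ = T.height i := by
    rw [Affine.Simplex.height, dist_comm, dist_eq_norm]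
  have h2 : ‖normal T i‖ = 1 := by
    rw [normal, norm_smul, h1, norm_inv, Real.norm_of_nonneg hp.le, inv_mul_cancel₀ hp.ne']
  rw [← EuclideanSpace.real_norm_sq_eq, h2, one_pow]

lemma cross_edges (T : Affine.Triangle ℝ Plane) (i : Fin 3) :
    cross (T.points (i + 1) - T.points i) (T.points (i + 2) - T.points (i + 1)) = jac T := by
  have e1 : (1 : Fin 3) + 1 = 2 := rfl
  have e2 : (1 : Fin 3) + 2 = 0 := rfl
  have e3 : (2 : Fin 3) + 1 = 0 := rfl
  have e4 : (2 : Fin 3) + 2 = 1 := rfl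
  fin_cases i <;> simp [jac, cross, side, e1, e2, e3, e4] <;> ring

lemma edge_endpoints_ne (T : Affine.Triangle ℝ Plane) (i : Fin 3) :
    T.points (i + 1) ≠ T.points (i + 2) := by
  have h : ∀ i : Fin 3, i + 1 ≠ i + 2 := by decide
  exact fun h' => h i (T.independent.injective h')

/-- Twice the area as base times height. The sign of `jac T` depends on the orientation, so the two
sides are compared through their squares. -/
lemma dist_mul_height (T : Affine.Triangle ℝ Plane) (i : Fin 3) :
    dist (T.points (i + 1)) (T.points (i + 2)) * T.height i = |jac T| := by
  have h1 : i ≠ i + 1 := by revert i; decide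
  have h2 : i ≠ i + 2 := by revert i; decide
  have n1 := inner_normal T h1
  have n2 := inner_normal T h2
  have n3 := norm_normal T i
  have hc := cross_edges T i
  have hd : dist (T.points (i + 1)) (T.points (i + 2)) ^ 2 =
      (T.points (i + 2) - T.points (i + 1)) 0 ^ 2 +
        (T.points (i + 2) - T.points (i + 1)) 1 ^ 2 := by
    rw [dist_comm, dist_eq_norm, EuclideanSpace.real_norm_sq_eq, Fin.sum_univ_two]
  have hne := edge_endpoints_ne T i
  have hd0 : 0 < dist (T.points (i + 1)) (T.points (i + 2)) := dist_pos.2 hne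
  have hp := T.height_pos i
  rw [← abs_of_pos (mul_pos hd0 hp)]
  refine (sq_eq_sq_iff_abs_eq_abs _ _).1 ?_
  rw [← hc]
  set d := dist (T.points (i + 1)) (T.points (i + 2))
  set h := T.height i
  generalize normal T i = n at *
  simp only [Fin.sum_univ_two, cross, PiLp.sub_apply] at n1 n2 n3 hd ⊢
  generalize T.points i = x at *
  generalize T.points (i + 1) = y at *
  generalize T.points (i + 2) = z at *
  have n4 : (z 0 - y 0) * n 0 + (z 1 - y 1) * n 1 = 0 := by linarith
  -- With `a = y - x` and `e = z - y`, this is `(a · n)(e · e) = (a × e)(n × e)`, valid because `n ·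
  -- e = 0`. The next identity is `(n × e)² = |e|²`, as `n` is a unit vector.
  have key1 : h * d ^ 2 = ((y 0 - x 0) * (z 1 - y 1) - (y 1 - x 1) * (z 0 - y 0)) *
      (n 0 * (z 1 - y 1) - n 1 * (z 0 - y 0)) := by
    rw [hd, ← n1]
    linear_combination ((y 0 - x 0) * (z 0 - y 0) + (y 1 - x 1) * (z 1 - y 1)) * n4
  have key2 : (n 0 * (z 1 - y 1) - n 1 * (z 0 - y 0)) ^ 2 = d ^ 2 := by
    rw [hd]
    linear_combination ((z 0 - y 0) ^ 2 + (z 1 - y 1) ^ 2) * n3 -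
      ((z 0 - y 0) * n 0 + (z 1 - y 1) * n 1) * n4
  have hd2 : d ^ 2 ≠ 0 := by positivity
  refine mul_right_cancel₀ hd2 ?_
  nth_rewrite 2 [← key2]
  linear_combination (h * d ^ 2 + ((y 0 - x 0) * (z 1 - y 1) - (y 1 - x 1) * (z 0 - y 0)) *
      (n 0 * (z 1 - y 1) - n 1 * (z 0 - y 0))) * key1

/-- Both sides of the triangle are differences of vectors issuing from the vertex `i`, and each
nonzero such vector has normal component equal to the height (`inner_normal`). The flux is therefore
the height times an integer combination of `u 0` and `u 1`, namely `refFlux`, and edge length times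
height is `|jac T|`. -/
lemma dist_mul_flux (T : Affine.Triangle ℝ Plane) (i : Fin 3) (u : Fin 2 → ℝ) :
    dist (T.points (i + 1)) (T.points (i + 2)) *
      ∑ l, (∑ j, u j * side T j l) * normal T i l = |jac T| * refFlux i u := by
  have h := dist_mul_height T i
  have e1 : (1 : Fin 3) + 1 = 2 := rfl
  have e2 : (1 : Fin 3) + 2 = 0 := rfl
  have e3 : (2 : Fin 3) + 1 = 0 := rfl
  have e4 : (2 : Fin 3) + 2 = 1 := rfl
  have key : ∀ i' j, i' ≠ j → ∑ l, (T.points j - T.points i') l * normal T i' l = T.height i' :=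
    fun i' j h => inner_normal T h
  rw [← h, mul_assoc]
  congr 1
  simp only [Fin.sum_univ_two, PiLp.sub_apply] at key ⊢
  fin_cases i
  · have k1 := key 0 1 (by decide)
    have k2 := key 0 2 (by decide)
    simp [refFlux, side]
    linear_combination u 0 * k1 + u 1 * k2
  · have k1 := key 1 0 (by decide)
    have k2 := key 1 2 (by decide)
    simp [refFlux, side]
    linear_combination (-u 0 - u 1) * k1 + u 1 * k2
  · have k1 := key 2 0 (by decide)
    have k2 := key 2 1 (by decide)
    simp [refFlux, side]
    linear_combination (-u 0 - u 1) * k1 + u 0 * k2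

/-! ### Size of a triangle -/

lemma isBounded_carrier (T : Affine.Triangle ℝ Plane) : Bornology.IsBounded (carrier T) :=
  (isCompact_carrier T).isBounded

lemma dist_points_le_diam (T : Affine.Triangle ℝ Plane) (i j : Fin 3) :
    dist (T.points i) (T.points j) ≤ Metric.diam (carrier T) :=
  Metric.dist_le_diam_of_mem (isBounded_carrier T)
    (subset_convexHull ℝ _ (mem_range_self i)) (subset_convexHull ℝ _ (mem_range_self j))

lemma side_sq_le (T : Affine.Triangle ℝ Plane) (j : Fin 2) :
    side T j 0 ^ 2 + side T j 1 ^ 2 ≤ Metric.diam (carrier T) ^ 2 := by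
  have := dist_points_le_diam T j.succ 0
  rw [dist_eq_norm] at this
  have h2 := pow_le_pow_left₀ (norm_nonneg _) this 2
  rwa [EuclideanSpace.real_norm_sq_eq, Fin.sum_univ_two] at h2

lemma diam_le_sides (T : Affine.Triangle ℝ Plane) :
    Metric.diam (carrier T) ≤ ‖side T 0‖ + ‖side T 1‖ := by
  rw [carrier, convexHull_diam]
  have h1 : dist (T.points 1) (T.points 0) = ‖side T 0‖ := dist_eq_norm _ _
  have h2 : dist (T.points 2) (T.points 0) = ‖side T 1‖ := dist_eq_norm _ _
  have h3 := dist_triangle (T.points 1) (T.points 0) (T.points 2)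
  have n1 := norm_nonneg (side T 0)
  have n2 := norm_nonneg (side T 1)
  have h4 := dist_comm (T.points 0) (T.points 1)
  have h5 := dist_comm (T.points 0) (T.points 2)
  have h6 := dist_comm (T.points 1) (T.points 2)
  refine Metric.diam_le_of_forall_dist_le (by positivity) ?_
  rintro _ ⟨i, rfl⟩ _ ⟨j, rfl⟩
  fin_cases i <;> fin_cases j <;> simp only [Fin.zero_eta, Fin.mk_one, Fin.reduceFinMk, dist_self]
    <;> linarith

lemma diam_pos (T : Affine.Triangle ℝ Plane) : 0 < Metric.diam (carrier T) := by
  have : T.points 0 ≠ T.points 1 := fun h => absurd (T.independent.injective h) (by decide)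
  exact (dist_pos.2 this).trans_le (dist_points_le_diam T 0 1)

lemma abs_jac_pos (T : Affine.Triangle ℝ Plane) : 0 < |jac T| := abs_pos.2 (jac_ne_zero T)

lemma abs_jac_le (T : Affine.Triangle ℝ Plane) : |jac T| ≤ Metric.diam (carrier T) ^ 2 := by
  have h0 := side_sq_le T 0
  have h1 := side_sq_le T 1
  rw [jac, cross, abs_le]
  constructor <;> nlinarith [sq_nonneg (side T 0 0 - side T 1 1), sq_nonneg (side T 0 1 + side T 1 0),
    sq_nonneg (side T 0 0 + side T 1 1), sq_nonneg (side T 0 1 - side T 1 0)]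

/-- A height never exceeds the diameter. With `h_T² ≤ K |jac T|` this keeps every edge at least as
long as `h_T / K`. -/
lemma abs_jac_le_dist_mul (T : Affine.Triangle ℝ Plane) (i : Fin 3) :
    |jac T| ≤ dist (T.points (i + 1)) (T.points (i + 2)) * Metric.diam (carrier T) := by
  rw [← dist_mul_height T i]
  refine mul_le_mul_of_nonneg_left ?_ dist_nonneg
  have h1 : i ≠ i + 1 := by revert i; decide
  rw [← inner_normal T h1, ← real_inner_plane]
  refine (real_inner_le_norm _ _).trans ?_
  have h2 : ‖normal T i‖ = 1 := by
    have := norm_normal T i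
    rw [← EuclideanSpace.real_norm_sq_eq] at this
    nlinarith [norm_nonneg (normal T i)]
  rw [h2, mul_one, ← dist_eq_norm]
  exact dist_points_le_diam T _ _

/-- The affine function `z ↦ cross (z - p) b / J` has slope `‖b‖ / |J|`, so along a suitable
diameter of the disc it varies by `r ‖b‖ / |J|`, whereas its values on `S` differ by at most one. -/
lemma rho_mul_norm_le {J r : ℝ} (hJ : J ≠ 0) (hr : 0 < r) (c p b : Plane) (S : Set Plane)
    (hS : Metric.closedBall c (r / 2) ⊆ S)
    (h : ∀ z ∈ S, cross (z - p) b / J ∈ Icc (0 : ℝ) 1) : r * ‖b‖ ≤ |J| := by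
  rcases eq_or_ne b 0 with rfl | hb
  · simp
  have hb' : 0 < ‖b‖ := norm_pos_iff.2 hb
  have hn := EuclideanSpace.real_norm_sq_eq b
  rw [Fin.sum_univ_two] at hn
  -- The direction of steepest ascent of `cross · b`: a quarter turn of `b`, scaled to the radius of
  -- the disc.
  set u : Plane := (r / 2 / ‖b‖) • !₂[b 1, -b 0] with hu
  have hun : ‖u‖ = r / 2 := by
    have : ‖(!₂[b 1, -b 0] : Plane)‖ = ‖b‖ := by
      rw [EuclideanSpace.norm_eq, EuclideanSpace.norm_eq]
      simp [Fin.sum_univ_two, add_comm]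
    rw [hu, norm_smul, this, Real.norm_of_nonneg (by positivity)]
    field_simp
  have h1 := h (c + u) (hS (by simp [hun]))
  have h2 := h (c - u) (hS (by simp [hun]))
  have h3 : cross (c + u - p) b / J - cross (c - u - p) b / J = r * ‖b‖ / J := by
    have h4 : cross (c + u - p) b - cross (c - u - p) b = r * ‖b‖ := by
      simp [cross, hu]
      field_simp
      rw [hn]
      ring
    rw [← sub_div, h4]
  have h5 : |r * ‖b‖ / J| ≤ 1 := by
    rw [← h3, abs_le]
    constructor <;> linarith [h1.1, h1.2, h2.1, h2.2]
  rwa [abs_div, div_le_one (abs_pos.2 hJ), abs_of_pos (by positivity)] at h5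

/-- The two coordinates of `chartInv T` are barycentric coordinates, hence lie in `[0, 1]` on the
triangle. Each bounds one side by `|jac T| / r`, and the diameter is at most the sum of these two
sides. -/
lemma rho_mul_diam_le (T : Affine.Triangle ℝ Plane) {c : Plane} {r : ℝ} (hr : 0 < r)
    (h : Metric.closedBall c (r / 2) ⊆ carrier T) :
    r * Metric.diam (carrier T) ≤ 2 * |jac T| := by
  have hJ := jac_ne_zero T
  have h1 := rho_mul_norm_le hJ hr c (T.points 0) (side T 1) _ h fun z hz => by
    obtain ⟨a1, a2, a3⟩ := (mem_carrier_iff T).1 hz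
    have e : cross (z - T.points 0) (side T 1) / jac T = chartInv T z 0 := by simp [chartInv]
    rw [e]
    exact ⟨a1, by linarith⟩
  have h2 := rho_mul_norm_le (neg_ne_zero.2 hJ) hr c (T.points 0) (side T 0) _ h fun z hz => by
    obtain ⟨a1, a2, a3⟩ := (mem_carrier_iff T).1 hz
    have e : cross (z - T.points 0) (side T 0) / -jac T = chartInv T z 1 := by
      simp [chartInv, cross]
      ring
    rw [e]
    exact ⟨a2, by linarith⟩
  rw [abs_neg] at h2
  nlinarith [diam_le_sides T]

lemma pullback_sq_le (T : Affine.Triangle ℝ Plane) (x : Fin 2 → ℝ) :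
    ∑ j, (∑ l, x l * side T j l) ^ 2 ≤ 2 * Metric.diam (carrier T) ^ 2 * ∑ l, x l ^ 2 := by
  simp only [Fin.sum_univ_two]
  have key : ∀ j, (x 0 * side T j 0 + x 1 * side T j 1) ^ 2 ≤
      Metric.diam (carrier T) ^ 2 * (x 0 ^ 2 + x 1 ^ 2) := fun j => by
    nlinarith [sq_nonneg (x 0 * side T j 1 - x 1 * side T j 0),
      mul_le_mul_of_nonneg_right (side_sq_le T j) (add_nonneg (sq_nonneg (x 0)) (sq_nonneg (x 1)))]
  linarith [key 0, key 1]

/-- Cramer's rule recovers `jac T • x` from the products of `x` with the two sides; Cauchy–Schwarz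
does the rest. -/
lemma sq_le_pullback (T : Affine.Triangle ℝ Plane) (x : Fin 2 → ℝ) :
    |jac T| ^ 2 * ∑ l, x l ^ 2 ≤
      2 * Metric.diam (carrier T) ^ 2 * ∑ j, (∑ l, x l * side T j l) ^ 2 := by
  have h0 := side_sq_le T 0
  have h1 := side_sq_le T 1
  rw [sq_abs]
  simp only [Fin.sum_univ_two]
  set y := x 0 * side T 0 0 + x 1 * side T 0 1 with hy
  set z := x 0 * side T 1 0 + x 1 * side T 1 1 with hz
  have e0 : jac T * x 0 = y * side T 1 1 - z * side T 0 1 := by rw [hy, hz, jac, cross]; ring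
  have e1 : jac T * x 1 = z * side T 0 0 - y * side T 1 0 := by rw [hy, hz, jac, cross]; ring
  have e2 : jac T ^ 2 * (x 0 ^ 2 + x 1 ^ 2) =
    (y * side T 1 1 - z * side T 0 1) ^ 2 + (z * side T 0 0 - y * side T 1 0) ^ 2 := by
    rw [← e0, ← e1]; ring
  rw [e2]
  nlinarith [sq_nonneg (y * side T 0 1 + z * side T 1 1), sq_nonneg (y * side T 0 0 + z * side T 1 0),
    mul_le_mul_of_nonneg_right (add_le_add h0 h1) (add_nonneg (sq_nonneg y) (sq_nonneg z))]

/-! ### The divergence theorem on the standard triangle -/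

/-- The edges of the standard triangle, parametrized from the vertex `i + 1` to `i + 2`. -/
def refEdge (i : Fin 3) (s : ℝ) : Plane := ![!₂[1 - s, s], !₂[0, 1 - s], !₂[s, 0]] i

lemma continuous_refEdge (i : Fin 3) : Continuous (refEdge i) := by
  unfold refEdge
  fin_cases i <;> simp <;> fun_prop

lemma chart_refEdge (T : Affine.Triangle ℝ Plane) (i : Fin 3) (s : ℝ) :
    chart T (refEdge i s) = AffineMap.lineMap (T.points (i + 1)) (T.points (i + 2)) s := by
  have e1 : (1 : Fin 3) + 1 = 2 := rfl
  have e2 : (1 : Fin 3) + 2 = 0 := rfl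
  have e3 : (2 : Fin 3) + 1 = 0 := rfl
  have e4 : (2 : Fin 3) + 2 = 1 := rfl
  rw [AffineMap.lineMap_apply_module]
  fin_cases i <;> simp [chart, refEdge, side, e1, e2, e3, e4] <;> module

lemma measurePreserving_pair :
    MeasurePreserving (fun p : ℝ × ℝ => (!₂[p.1, p.2] : Plane)) := by
  have h1 := (PiLp.volume_preserving_toLp (Fin 2))
  have h2 := (volume_preserving_finTwoArrow ℝ).symm
  exact h1.comp h2

lemma measurableEmbedding_pair :
    MeasurableEmbedding (fun p : ℝ × ℝ => (!₂[p.1, p.2] : Plane)) := by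
  have h : Function.LeftInverse (fun x : Plane => (x 0, x 1))
    (fun p : ℝ × ℝ => (!₂[p.1, p.2] : Plane)) := fun p => by simp
  have hc : Continuous (fun p : ℝ × ℝ => (!₂[p.1, p.2] : Plane)) := by fun_prop
  exact hc.measurableEmbedding h.injective

/-- The standard triangle as a set of pairs. -/
def refPairs : Set (ℝ × ℝ) := {p | 0 ≤ p.1 ∧ 0 ≤ p.2 ∧ p.1 + p.2 ≤ 1}

lemma isCompact_refPairs : IsCompact refPairs := by
  have hc : IsClosed refPairs := by
    have h : refPairs = {x : ℝ × ℝ | 0 ≤ x.1} ∩ ({x | 0 ≤ x.2} ∩ {x | x.1 + x.2 ≤ 1}) := rfl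
    rw [h]
    refine (isClosed_le ?_ ?_).inter ((isClosed_le ?_ ?_).inter (isClosed_le ?_ ?_)) <;> fun_prop
  refine (isCompact_Icc (a := ((0 : ℝ), (0 : ℝ))) (b := (1, 1))).of_isClosed_subset hc ?_
  rintro ⟨x, y⟩ ⟨h1, h2, h3⟩
  simp only at h1 h2 h3
  exact ⟨⟨h1, h2⟩, ⟨by simp; linarith, by simp; linarith⟩⟩

lemma isCompact_refTriangle : IsCompact refTriangle := by
  have : refTriangle = (fun p : ℝ × ℝ => (!₂[p.1, p.2] : Plane)) '' refPairs := by
    ext x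
    constructor
    · intro hx
      exact ⟨(x 0, x 1), hx, by ext i; fin_cases i <;> simp⟩
    · rintro ⟨p, hp, rfl⟩
      exact hp
  rw [this]
  exact isCompact_refPairs.image (by fun_prop)

lemma setIntegral_refTriangle_eq (f : Plane → ℝ) :
    ∫ x in refTriangle, f x = ∫ p in refPairs, f !₂[p.1, p.2] := by
  rw [← measurePreserving_pair.setIntegral_preimage_emb measurableEmbedding_pair]
  rfl

lemma setIntegral_refPairs {g : ℝ × ℝ → ℝ} (hg : Continuous g) :
    ∫ p in refPairs, g p = ∫ s in (0 : ℝ)..1, ∫ t in (0 : ℝ)..(1 - s), g (s, t) := by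
  have hm := isCompact_refPairs.isClosed.measurableSet
  have hi : Integrable (indicator refPairs g) (volume.prod volume) := by
    rw [integrable_indicator_iff hm]
    exact hg.continuousOn.integrableOn_compact isCompact_refPairs
  rw [← integral_indicator hm, Measure.volume_eq_prod, integral_prod _ hi,
    intervalIntegral.integral_of_le zero_le_one, ← integral_Icc_eq_integral_Ioc,
    ← integral_indicator measurableSet_Icc]
  congr 1
  ext s
  by_cases hs : s ∈ Icc (0 : ℝ) 1
  · rw [indicator_of_mem hs, intervalIntegral.integral_of_le (by linarith [hs.2]),
      ← integral_Icc_eq_integral_Ioc, ← integral_indicator measurableSet_Icc]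
    congr 1
    ext t
    by_cases ht : t ∈ Icc (0 : ℝ) (1 - s)
    · rw [indicator_of_mem ht, indicator_of_mem]
      exact ⟨hs.1, ht.1, by have := ht.2; simp; linarith⟩
    · rw [indicator_of_notMem ht, indicator_of_notMem]
      rintro ⟨-, h2, h3⟩
      exact ht ⟨h2, by simp at h3; linarith⟩
  · rw [indicator_of_notMem hs]
    have : ∀ t, indicator refPairs g (s, t) = 0 := fun t => by
      rw [indicator_of_notMem]
      rintro ⟨h1, h2, h3⟩
      simp only at h1 h2 h3
      exact hs ⟨h1, by linarith⟩
    simp [this]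

lemma setIntegral_refPairs_swap {g : ℝ × ℝ → ℝ} (hg : Continuous g) :
    ∫ p in refPairs, g p = ∫ t in (0 : ℝ)..1, ∫ s in (0 : ℝ)..(1 - t), g (s, t) := by
  have h := (Measure.measurePreserving_swap (μ := (volume : Measure ℝ))
    (ν := (volume : Measure ℝ))).setIntegral_preimage_emb
    (MeasurableEquiv.prodComm (α := ℝ) (β := ℝ)).measurableEmbedding g refPairs
  have h2 : Prod.swap ⁻¹' refPairs = refPairs := by
    ext p
    simp only [refPairs, mem_preimage, mem_ofPred_eq, Prod.fst_swap, Prod.snd_swap]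
    constructor <;> rintro ⟨h1, h2, h3⟩ <;> exact ⟨h2, h1, by linarith⟩
  rw [h2] at h
  rw [← Measure.volume_eq_prod] at h
  have hg' : Continuous fun p : ℝ × ℝ => g p.swap := hg.comp continuous_swap
  rw [← h, setIntegral_refPairs hg']
  rfl

lemma setIntegral_refTriangle_fderiv_one {f : Plane → ℝ} (hf : ContDiff ℝ 1 f) :
    ∫ x in refTriangle, fderiv ℝ f x (EuclideanSpace.single 1 1) =
      (∫ s in (0 : ℝ)..1, f (refEdge 0 s)) - ∫ s in (0 : ℝ)..1, f (refEdge 2 s) := by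
  have hc : Continuous fun x => fderiv ℝ f x (EuclideanSpace.single 1 1) :=
    (hf.continuous_fderiv (by simp)).clm_apply continuous_const
  have hc' : Continuous fun p : ℝ × ℝ => fderiv ℝ f !₂[p.1, p.2] (EuclideanSpace.single 1 1) :=
    hc.comp (by fun_prop)
  rw [setIntegral_refTriangle_eq, setIntegral_refPairs hc']
  have h1 : ∀ s : ℝ, ∫ t in (0 : ℝ)..(1 - s), fderiv ℝ f !₂[s, t] (EuclideanSpace.single 1 1) =
      f !₂[s, 1 - s] - f !₂[s, 0] := fun s => by
    refine intervalIntegral.integral_eq_sub_of_hasDerivAt (f := fun t => f !₂[s, t]) ?_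
      ((hc.comp (by fun_prop)).intervalIntegrable _ _)
    intro t _
    have h := ((hf.differentiable (by simp)) !₂[s, t]).hasFDerivAt
    have h2 : HasDerivAt (fun t : ℝ => (!₂[s, t] : Plane)) (EuclideanSpace.single 1 1) t := by
      have h3 := ((hasDerivAt_id t).smul_const (EuclideanSpace.single (1 : Fin 2) (1 : ℝ))).const_add
        (!₂[s, 0] : Plane)
      rw [one_smul] at h3
      have h4 : (fun r : ℝ => (!₂[s, r] : Plane)) =
          fun r => (!₂[s, 0] : Plane) + id r • EuclideanSpace.single 1 (1 : ℝ) := by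
        ext r i
        fin_cases i <;> simp
      rw [h4]
      exact h3
    exact h.comp_hasDerivAt t h2
  simp only [h1]
  have c0 : Continuous fun s : ℝ => f !₂[s, 1 - s] := hf.continuous.comp (by fun_prop)
  have c1 : Continuous fun s : ℝ => f !₂[s, 0] := hf.continuous.comp (by fun_prop)
  rw [intervalIntegral.integral_sub (c0.intervalIntegrable _ _) (c1.intervalIntegrable _ _)]
  congr 1
  -- `refEdge 0` runs through the hypotenuse from `(1, 0)` to `(0, 1)`, against the direction of the
  -- slicing variable.
  have := intervalIntegral.integral_comp_sub_left (a := 0) (b := 1)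
    (fun s : ℝ => f !₂[s, 1 - s]) 1
  simp at this
  rw [← this]
  rfl

lemma setIntegral_refTriangle_fderiv_zero {f : Plane → ℝ} (hf : ContDiff ℝ 1 f) :
    ∫ x in refTriangle, fderiv ℝ f x (EuclideanSpace.single 0 1) =
      (∫ s in (0 : ℝ)..1, f (refEdge 0 s)) - ∫ s in (0 : ℝ)..1, f (refEdge 1 s) := by
  have hc : Continuous fun x => fderiv ℝ f x (EuclideanSpace.single 0 1) :=
    (hf.continuous_fderiv (by simp)).clm_apply continuous_const
  have hc' : Continuous fun p : ℝ × ℝ => fderiv ℝ f !₂[p.1, p.2] (EuclideanSpace.single 0 1) :=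
    hc.comp (by fun_prop)
  rw [setIntegral_refTriangle_eq, setIntegral_refPairs_swap hc']
  have h1 : ∀ t : ℝ, ∫ s in (0 : ℝ)..(1 - t), fderiv ℝ f !₂[s, t] (EuclideanSpace.single 0 1) =
      f !₂[1 - t, t] - f !₂[0, t] := fun t => by
    refine intervalIntegral.integral_eq_sub_of_hasDerivAt (f := fun s => f !₂[s, t]) ?_
      ((hc.comp (by fun_prop)).intervalIntegrable _ _)
    intro s _
    have h := ((hf.differentiable (by simp)) !₂[s, t]).hasFDerivAt
    have h2 : HasDerivAt (fun s : ℝ => (!₂[s, t] : Plane)) (EuclideanSpace.single 0 1) s := by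
      have h3 := ((hasDerivAt_id s).smul_const (EuclideanSpace.single (0 : Fin 2) (1 : ℝ))).const_add
        (!₂[0, t] : Plane)
      rw [one_smul] at h3
      have h4 : (fun r : ℝ => (!₂[r, t] : Plane)) =
          fun r => (!₂[0, t] : Plane) + id r • EuclideanSpace.single 0 (1 : ℝ) := by
        ext r i
        fin_cases i <;> simp
      rw [h4]
      exact h3
    exact h.comp_hasDerivAt s h2
  simp only [h1]
  have c0 : Continuous fun s : ℝ => f !₂[1 - s, s] := hf.continuous.comp (by fun_prop)
  have c1 : Continuous fun s : ℝ => f !₂[0, s] := hf.continuous.comp (by fun_prop)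
  rw [intervalIntegral.integral_sub (c0.intervalIntegrable _ _) (c1.intervalIntegrable _ _)]
  congr 1
  have := intervalIntegral.integral_comp_sub_left (a := 0) (b := 1)
    (fun s : ℝ => f !₂[0, s]) 1
  simp at this
  rw [← this]
  rfl

lemma divergence_refTriangle {f : Fin 2 → Plane → ℝ} (hf : ∀ j, ContDiff ℝ 1 (f j)) :
    ∫ x in refTriangle, ∑ j, fderiv ℝ (f j) x (EuclideanSpace.single j 1) =
      ∑ i, ∫ s in (0 : ℝ)..1, refFlux i fun j => f j (refEdge i s) := by
  have hi : ∀ j, IntegrableOn (fun x => fderiv ℝ (f j) x (EuclideanSpace.single j 1)) refTriangle :=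
    fun j => (((hf j).continuous_fderiv (by simp)).clm_apply
      continuous_const).continuousOn.integrableOn_compact isCompact_refTriangle
  have hc : ∀ i j, IntervalIntegrable (fun s => f j (refEdge i s)) volume 0 1 := fun i j =>
    ((hf j).continuous.comp (continuous_refEdge i)).intervalIntegrable _ _
  rw [integral_finsetSum _ fun j _ => hi j, Fin.sum_univ_two, Fin.sum_univ_three,
    setIntegral_refTriangle_fderiv_one (hf 1), setIntegral_refTriangle_fderiv_zero (hf 0)]
  simp only [refFlux, Matrix.cons_val_zero, Matrix.cons_val_one, Matrix.cons_val]
  rw [intervalIntegral.integral_add (hc 0 0) (hc 0 1), intervalIntegral.integral_neg,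
    intervalIntegral.integral_neg]
  ring

/-! ### Forms on finite-dimensional spaces -/

/-- In coordinates the quotient `A x x / B x x` is continuous on the unit sphere, hence bounded
there by compactness; both forms are homogeneous of degree two. -/
lemma exists_form_le {E : Type*} [AddCommGroup E] [Module ℝ E] [FiniteDimensional ℝ E]
    (A B : E →ₗ[ℝ] E →ₗ[ℝ] ℝ) (hB : ∀ x, x ≠ 0 → 0 < B x x) :
    ∃ C : ℝ, 0 < C ∧ ∀ x, A x x ≤ C * B x x := by
  let b := Module.finBasis ℝ E
  have hc : ∀ F : E →ₗ[ℝ] E →ₗ[ℝ] ℝ,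
      Continuous fun y : Fin (Module.finrank ℝ E) → ℝ => F (b.equivFun.symm y) (b.equivFun.symm y) := by
    intro F
    simp only [Module.Basis.equivFun_symm_apply, map_sum, map_smul, LinearMap.sum_apply,
      LinearMap.smul_apply, smul_eq_mul]
    fun_prop
  have hpos : ∀ y : Fin (Module.finrank ℝ E) → ℝ, y ≠ 0 →
      0 < B (b.equivFun.symm y) (b.equivFun.symm y) := fun y hy =>
    hB _ ((LinearEquiv.map_ne_zero_iff _).2 hy)
  have hcont : ContinuousOn (fun y : Fin (Module.finrank ℝ E) → ℝ =>
      A (b.equivFun.symm y) (b.equivFun.symm y) / B (b.equivFun.symm y) (b.equivFun.symm y))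
      (Metric.sphere 0 1) :=
    (hc A).continuousOn.div (hc B).continuousOn fun y hy =>
      (hpos y (ne_zero_of_mem_unit_sphere ⟨y, hy⟩)).ne'
  obtain ⟨C, hC⟩ := (isCompact_sphere _ _).bddAbove_image hcont
  -- The bound on the sphere need not be positive, so it is raised to at least one.
  refine ⟨max C 1, by positivity, fun x => ?_⟩
  rcases eq_or_ne x 0 with rfl | hx
  · simp
  set y := b.equivFun x with hy
  have hy0 : y ≠ 0 := by simpa [hy] using hx
  have hn : 0 < ‖y‖ := norm_pos_iff.2 hy0
  have hx' : x = ‖y‖ • b.equivFun.symm (‖y‖⁻¹ • y) := by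
    rw [← map_smul, smul_smul, mul_inv_cancel₀ hn.ne', one_smul, hy, LinearEquiv.symm_apply_apply]
  have hs : ‖y‖⁻¹ • y ∈ Metric.sphere (0 : Fin (Module.finrank ℝ E) → ℝ) 1 := by
    simp [norm_smul, hn.ne']
  have h1 := hC (mem_image_of_mem _ hs)
  have h2 := hpos _ (ne_zero_of_mem_unit_sphere ⟨_, hs⟩)
  rw [div_le_iff₀ h2] at h1
  have h3 := h1.trans (mul_le_mul_of_nonneg_right (le_max_left C 1) h2.le)
  have h4 := mul_le_mul_of_nonneg_left h3 (mul_self_nonneg ‖y‖)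
  rw [hx']
  simp only at h4
  generalize b.equivFun.symm (‖y‖⁻¹ • y) = z at h4 ⊢
  simp only [map_smul, LinearMap.smul_apply, smul_eq_mul]
  linarith

/-- The `L²` inner product on a space of functions with integrable products. -/
def l2Form {X : Type*} [MeasurableSpace X] (ν : Measure X) (S : Submodule ℝ (X → ℝ))
    (h : ∀ f ∈ S, ∀ g ∈ S, Integrable (fun x => f x * g x) ν) : S →ₗ[ℝ] S →ₗ[ℝ] ℝ :=
  LinearMap.mk₂ ℝ (fun f g => ∫ x, (f : X → ℝ) x * (g : X → ℝ) x ∂ν)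
    (fun f f' g => by
      rw [← integral_add (h _ f.2 _ g.2) (h _ f'.2 _ g.2)]
      simp only [Submodule.coe_add, Pi.add_apply, add_mul])
    (fun c f g => by
      rw [smul_eq_mul, ← integral_const_mul]
      simp only [Submodule.coe_smul, Pi.smul_apply, smul_eq_mul, mul_assoc])
    (fun f g g' => by
      rw [← integral_add (h _ f.2 _ g.2) (h _ f.2 _ g'.2)]
      simp only [Submodule.coe_add, Pi.add_apply, mul_add])
    (fun c f g => by
      rw [smul_eq_mul, ← integral_const_mul]
      simp only [Submodule.coe_smul, Pi.smul_apply, smul_eq_mul, mul_left_comm])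

/-- The `L²` inner product of polynomials on the standard triangle. -/
def triForm (m : ℕ) : PolyFun m →ₗ[ℝ] PolyFun m →ₗ[ℝ] ℝ :=
  l2Form (volume.restrict refTriangle) (PolyFun m) fun f hf g hg =>
    ((polyFun_continuous ⟨f, hf⟩).mul
      (polyFun_continuous ⟨g, hg⟩)).continuousOn.integrableOn_compact isCompact_refTriangle

/-- The `L²` inner product of polynomials on the unit interval. -/
def lineForm (m : ℕ) : LinePoly m →ₗ[ℝ] LinePoly m →ₗ[ℝ] ℝ :=
  l2Form (volume.restrict (Ioc 0 1)) (LinePoly m) fun _ hf _ hg =>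
    (((linePoly_continuous hf).mul (linePoly_continuous hg)).continuousOn.integrableOn_compact
      isCompact_Icc).mono_set Ioc_subset_Icc_self

lemma triForm_apply {m : ℕ} (f g : PolyFun m) :
    triForm m f g = ∫ x in refTriangle, (f : Plane → ℝ) x * (g : Plane → ℝ) x := rfl

lemma lineForm_apply {m : ℕ} (f g : LinePoly m) :
    lineForm m f g = ∫ s in (0 : ℝ)..1, (f : ℝ → ℝ) s * (g : ℝ → ℝ) s := by
  rw [intervalIntegral.integral_of_le zero_le_one]
  rfl

/-- The interior of the standard triangle. -/
def refInterior : Set Plane := {x | 0 < x 0 ∧ 0 < x 1 ∧ x 0 + x 1 < 1}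

lemma isOpen_refInterior : IsOpen refInterior := by
  have h : refInterior = {x : Plane | 0 < x 0} ∩ ({x | 0 < x 1} ∩ {x | x 0 + x 1 < 1}) := rfl
  rw [h]
  refine (isOpen_lt ?_ ?_).inter ((isOpen_lt ?_ ?_).inter (isOpen_lt ?_ ?_)) <;> fun_prop

lemma refInterior_nonempty : refInterior.Nonempty :=
  ⟨!₂[1 / 3, 1 / 3], by simp [refInterior]; norm_num⟩

lemma refInterior_subset : refInterior ⊆ refTriangle :=
  fun _ hx => ⟨hx.1.le, hx.2.1.le, hx.2.2.le⟩

lemma eqOn_refInterior_of_integral_eq_zero {f : Plane → ℝ} (hf : Continuous f)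
    (h0 : ∀ x ∈ refTriangle, 0 ≤ f x) (h : ∫ x in refTriangle, f x = 0) :
    EqOn f 0 refInterior := by
  rw [setIntegral_eq_zero_iff_of_nonneg_ae
    ((ae_restrict_iff' isClosed_refTriangle.measurableSet).2 (ae_of_all _ h0))
    (hf.continuousOn.integrableOn_compact isCompact_refTriangle)] at h
  exact Measure.eqOn_open_of_ae_eq (ae_restrict_of_ae_restrict_of_subset refInterior_subset h)
    isOpen_refInterior hf.continuousOn continuousOn_const

lemma triForm_self_nonneg {m : ℕ} (f : PolyFun m) : 0 ≤ triForm m f f :=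
  integral_nonneg fun _ => mul_self_nonneg _

lemma triForm_definite {m : ℕ} {f : PolyFun m} (h : triForm m f f = 0) : f = 0 := by
  refine polyFun_eq_zero_of_eqOn f isOpen_refInterior refInterior_nonempty fun x hx => ?_
  have := eqOn_refInterior_of_integral_eq_zero ((polyFun_continuous f).mul (polyFun_continuous f))
    (fun x _ => mul_self_nonneg _) h hx
  exact mul_self_eq_zero.1 this

lemma lineForm_self_nonneg {m : ℕ} (f : LinePoly m) : 0 ≤ lineForm m f f :=
  integral_nonneg fun _ => mul_self_nonneg _

lemma eqOn_Icc_of_integral_eq_zero {f : ℝ → ℝ} (hf : Continuous f) (h0 : ∀ x, 0 ≤ f x)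
    (h : ∫ s in (0 : ℝ)..1, f s = 0) : EqOn f 0 (Icc 0 1) := by
  rw [intervalIntegral.integral_of_le zero_le_one,
    integral_eq_zero_iff_of_nonneg (fun x => h0 x)
    ((hf.continuousOn.integrableOn_compact isCompact_Icc).mono_set Ioc_subset_Icc_self)] at h
  have h1 : EqOn f 0 (Ioo 0 1) := Measure.eqOn_open_of_ae_eq
    (ae_restrict_of_ae_restrict_of_subset Ioo_subset_Ioc_self h)
    isOpen_Ioo hf.continuousOn continuousOn_const
  rw [← closure_Ioo zero_ne_one]
  exact h1.closure hf continuous_const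

lemma lineForm_definite {m : ℕ} {f : LinePoly m} (h : lineForm m f f = 0) : f = 0 := by
  have hc := linePoly_continuous f.2
  rw [lineForm_apply] at h
  refine Subtype.ext (linePoly_eq_zero_of_eqOn f.2 fun s hs => ?_)
  exact mul_self_eq_zero.1 (eqOn_Icc_of_integral_eq_zero (hc.mul hc) (fun x => mul_self_nonneg _) h hs)

/-! ### The reference problem -/

lemma refEdge_eq (i : Fin 3) : ∃ c d : Fin 2 → ℝ, ∀ s j, refEdge i s j = c j + s * d j := by
  refine ⟨fun j => refEdge i 0 j, fun j => refEdge i 1 j - refEdge i 0 j, fun s j => ?_⟩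
  fin_cases i <;> fin_cases j <;> simp [refEdge] <;> ring

/-- The normal trace of a vector-valued polynomial on an edge of the standard triangle. -/
def normalTrace (m : ℕ) (i : Fin 3) : VecPoly m →ₗ[ℝ] LinePoly m where
  toFun q := ⟨fun s => refFlux i fun j => (q j : Plane → ℝ) (refEdge i s), by
    obtain ⟨c, d, h⟩ := refEdge_eq i
    have h1 := fun j => comp_line_mem_linePoly (q j).2 (refEdge i) c d h
    unfold refFlux
    fin_cases i
    · exact (LinePoly m).add_mem (h1 0) (h1 1)
    · exact (LinePoly m).neg_mem (h1 0)
    · exact (LinePoly m).neg_mem (h1 1)⟩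
  map_add' q r := by
    ext s
    fin_cases i <;> simp [refFlux] <;> ring
  map_smul' c q := by
    ext s
    fin_cases i <;> simp [refFlux]
    ring

lemma normalTrace_apply {m : ℕ} (i : Fin 3) (q : VecPoly m) (s : ℝ) :
    (normalTrace m i q : ℝ → ℝ) s = refFlux i fun j => (q j : Plane → ℝ) (refEdge i s) := rfl

/-- The data of the reference problem: a field `g` in the place of the gradient, edge polynomials
`μ` in the place of the jumps `v₀ - v_b`, and a field `w` in the place of the weak gradient. -/
abbrev RefData (k : ℕ) : Type :=
  (Fin 2 → PolyFun (k - 1)) × (Fin 3 → LinePoly (k + 1)) × VecPoly (k + 1)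

lemma polyFun_pred_le (k : ℕ) : PolyFun (k - 1) ≤ PolyFun (k + 1) := polyFun_mono (by lia)

/-- The data with `(w, q) = (g, q) - ⟨μ, q · n⟩` for all `q`. -/
def refSpace (k : ℕ) : Submodule ℝ (RefData k) where
  carrier := {d | ∀ q : VecPoly (k + 1), ∑ j, triForm _ (d.2.2 j) (q j) =
    ∑ j, triForm _ (Submodule.inclusion (polyFun_pred_le k) (d.1 j)) (q j) -
      ∑ i, lineForm _ (d.2.1 i) (normalTrace _ i q)}
  add_mem' {d d'} h h' q := by
    have := h q
    have := h' q
    simp only [Prod.snd_add, Prod.fst_add, Pi.add_apply, map_add, LinearMap.add_apply,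
      Finset.sum_add_distrib]
    linarith
  zero_mem' q := by simp
  smul_mem' c d h q := by
    have := h q
    simp only [Prod.smul_snd, Prod.smul_fst, Pi.smul_apply, map_smul, LinearMap.smul_apply,
      smul_eq_mul, ← Finset.mul_sum]
    rw [this]
    ring

/-- The unisolvence at the heart of the theorem: `[P_{k+1}]²` contains enough test fields to detect
`g` in the interior and each `μ i` on its own edge. -/
lemma refSpace_data_eq_zero {k : ℕ} (hk : 1 ≤ k) {d : RefData k} (hd : d ∈ refSpace k)
    (hw : d.2.2 = 0) : d.1 = 0 ∧ d.2.1 = 0 := by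
  obtain ⟨g, μ, w⟩ := d
  obtain rfl : w = 0 := hw
  simp only
  have eqn : ∀ q : VecPoly (k + 1),
      ∑ j, ∫ x in refTriangle, (g j : Plane → ℝ) x * (q j : Plane → ℝ) x =
        ∑ i, ∫ s in (0 : ℝ)..1,
          (μ i : ℝ → ℝ) s * refFlux i fun j => (q j : Plane → ℝ) (refEdge i s) := fun q => by
    have h := hd q
    simp only [lineForm_apply, normalTrace_apply, triForm_apply, Pi.zero_apply,
      ZeroMemClass.coe_zero, zero_mul, integral_zero, Finset.sum_const_zero,
      Submodule.coe_inclusion] at h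
    linarith
  have hc := fun j : Fin 2 => coord_mem_polyFun j
  have h0 : (fun x : Plane => 1 - x 0 - x 1) ∈ PolyFun 1 :=
    sub_mem_polyFun (sub_mem_polyFun (const_mem_polyFun _ 1) (hc 0)) (hc 1)
  have hg : g = 0 := by
    -- The weight `(1 - x₀ - x₁) x_j` vanishes on the hypotenuse and on the leg whose normal is the
    -- `j`-th axis, so the field has zero normal trace everywhere; it is positive inside. The degree
    -- is `2 + (k - 1) = k + 1`, which is where `k ≥ 1` enters.
    have hq : ∀ j, (fun x : Plane => (1 - x 0 - x 1) * x j * (g j : Plane → ℝ) x) ∈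
        PolyFun (k + 1) := fun j =>
      polyFun_mono (by lia) (mul_mem_polyFun (mul_mem_polyFun h0 (hc j)) (g j).2)
    have h := eqn fun j => ⟨_, hq j⟩
    simp only at h
    have hz : ∀ i s, refFlux i (fun j => (1 - refEdge i s 0 - refEdge i s 1) * refEdge i s j *
        (g j : Plane → ℝ) (refEdge i s)) = 0 := fun i s => by
      fin_cases i <;> simp [refFlux, refEdge]
    simp only [hz, mul_zero, intervalIntegral.integral_zero, Finset.sum_const_zero] at h
    have hnn : ∀ j, ∀ x ∈ refTriangle, 0 ≤ (g j : Plane → ℝ) x *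
        ((1 - x 0 - x 1) * x j * (g j : Plane → ℝ) x) := by
      rintro j x ⟨h1, h2, h3⟩
      have h4 : 0 ≤ x j := by fin_cases j <;> assumption
      have h5 : 0 ≤ 1 - x 0 - x 1 := by linarith
      have := mul_nonneg (mul_nonneg h5 h4) (mul_self_nonneg ((g j : Plane → ℝ) x))
      linarith
    have hj := (Finset.sum_eq_zero_iff_of_nonneg fun j _ =>
      setIntegral_nonneg isClosed_refTriangle.measurableSet (hnn j)).1 h
    funext j
    refine polyFun_eq_zero_of_eqOn (g j) isOpen_refInterior refInterior_nonempty fun x hx => ?_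
    have hx0 := eqOn_refInterior_of_integral_eq_zero
      ((polyFun_continuous (g j)).mul (polyFun_continuous ⟨_, hq j⟩)) (hnn j)
      (hj j (Finset.mem_univ j)) hx
    obtain ⟨h1, h2, h3⟩ := hx
    have h4 : x j ≠ 0 := by fin_cases j <;> [exact h1.ne'; exact h2.ne']
    have h5 : 1 - x 0 - x 1 ≠ 0 := by linarith
    simpa [h4, h5] using hx0
  refine ⟨hg, ?_⟩
  subst hg
  simp only [Pi.zero_apply, ZeroMemClass.coe_zero, zero_mul, integral_zero,
    Finset.sum_const_zero] at eqn
  -- A field with normal trace `μ i` on edge `i` and zero on the others reduces the equation to `∫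
  -- (μ i)² = 0`.
  have concl : ∀ (i : Fin 3) (q : VecPoly (k + 1)),
      (∀ i' s, i' ≠ i → refFlux i' (fun j => (q j : Plane → ℝ) (refEdge i' s)) = 0) →
      (∀ s, refFlux i (fun j => (q j : Plane → ℝ) (refEdge i s)) = (μ i : ℝ → ℝ) s) → μ i = 0 := by
    intro i q h1 h2
    have h := eqn q
    rw [Finset.sum_eq_single i (fun i' _ hi => by simp [h1 i' _ hi]) (by simp)] at h
    simp only [h2] at h
    exact lineForm_definite ((lineForm_apply _ _).trans h.symm)
  have hcm : ∀ {u : Plane → ℝ} (c : ℝ), u ∈ PolyFun 1 → (fun x => u x * c) ∈ PolyFun (k + 1) :=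
    fun c hu => polyFun_mono (by lia) (mul_mem_polyFun hu (const_mem_polyFun 0 c))
  have hrm : ∀ {u v : Plane → ℝ} {r : Polynomial ℝ}, r.natDegree ≤ k → u ∈ PolyFun 1 →
      v ∈ PolyFun 1 → (fun x => u x * r.eval (v x)) ∈ PolyFun (k + 1) := fun hr hu hv =>
    polyFun_mono (by lia) (mul_mem_polyFun hu (polynomial_comp_mem_polyFun hr hv))
  funext i
  obtain ⟨c, r, hr, hμ⟩ := linePoly_decomposition (μ i).2
  fin_cases i
  -- In all three cases the barycentric coordinate of each endpoint of edge `i` multiplies a vector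
  -- tangent to the other edge at that endpoint. The coordinate vanishes on the third edge, and the
  -- tangent vector has no flux through the edge it follows.
  · refine concl 0 ![⟨_, hcm c (hc 0)⟩, ⟨_, hrm hr (hc 1) (hc 1)⟩] (fun i' s hi => ?_) fun s => ?_
    · fin_cases i'
      · exact absurd rfl hi
      · simp [refFlux, refEdge]
      · simp [refFlux, refEdge]
    · simp only [Fin.zero_eta] at hμ
      simp [hμ, refFlux, refEdge]
  · refine concl 1 ![⟨_, sub_mem_polyFun ((PolyFun _).neg_mem (hcm c (hc 1))) (hrm hr h0 h0)⟩,
      ⟨_, hcm c (hc 1)⟩] (fun i' s hi => ?_) fun s => ?_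
    · fin_cases i'
      · simp [refFlux, refEdge]
      · exact absurd rfl hi
      · simp [refFlux, refEdge]
    · simp only [Fin.mk_one] at hμ
      simp [hμ, refFlux, refEdge]
      ring
  · refine concl 2 ![⟨_, hrm hr (hc 0) (hc 0)⟩, ⟨_, sub_mem_polyFun
      ((PolyFun _).neg_mem (hrm hr (hc 0) (hc 0))) (hcm c h0)⟩] (fun i' s hi => ?_) fun s => ?_
    · fin_cases i'
      · simp [refFlux, refEdge]
      · simp [refFlux, refEdge]
      · exact absurd rfl hi
    · simp only [Fin.reduceFinMk] at hμ
      simp [hμ, refFlux, refEdge]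
-- On `refSpace k` both quadratic forms are positive definite, so compactness bounds each by the
-- other. No triangle enters, so the constant depends on `k` alone.
theorem exists_reference_equivalence {k : ℕ} (hk : 1 ≤ k) : ∃ C : ℝ, 0 < C ∧
    ∀ (g : Fin 2 → PolyFun (k - 1)) (μ : Fin 3 → LinePoly (k + 1)) (w : VecPoly (k + 1)),
      (∀ q : VecPoly (k + 1), ∑ j, ∫ x in refTriangle, (w j : Plane → ℝ) x * (q j : Plane → ℝ) x =
        ∑ j, (∫ x in refTriangle, (g j : Plane → ℝ) x * (q j : Plane → ℝ) x) -
          ∑ i, ∫ s in (0 : ℝ)..1,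
            (μ i : ℝ → ℝ) s * refFlux i fun j => (q j : Plane → ℝ) (refEdge i s)) →
      ∑ j, ∫ x in refTriangle, (w j : Plane → ℝ) x * (w j : Plane → ℝ) x ≤
          C * (∑ j, (∫ x in refTriangle, (g j : Plane → ℝ) x * (g j : Plane → ℝ) x) +
            ∑ i, ∫ s in (0 : ℝ)..1, (μ i : ℝ → ℝ) s * (μ i : ℝ → ℝ) s) ∧
      ∑ j, (∫ x in refTriangle, (g j : Plane → ℝ) x * (g j : Plane → ℝ) x) +
          ∑ i, ∫ s in (0 : ℝ)..1, (μ i : ℝ → ℝ) s * (μ i : ℝ → ℝ) s ≤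
        C * ∑ j, ∫ x in refTriangle, (w j : Plane → ℝ) x * (w j : Plane → ℝ) x := by
  let S := refSpace k
  let pw : Fin 2 → S →ₗ[ℝ] PolyFun (k + 1) := fun j =>
    LinearMap.proj j ∘ₗ LinearMap.snd ℝ _ _ ∘ₗ LinearMap.snd ℝ _ _ ∘ₗ S.subtype
  let pg : Fin 2 → S →ₗ[ℝ] PolyFun (k - 1) := fun j =>
    LinearMap.proj j ∘ₗ LinearMap.fst ℝ _ _ ∘ₗ S.subtype
  let pμ : Fin 3 → S →ₗ[ℝ] LinePoly (k + 1) := fun i =>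
    LinearMap.proj i ∘ₗ LinearMap.fst ℝ _ _ ∘ₗ LinearMap.snd ℝ _ _ ∘ₗ S.subtype
  let A : S →ₗ[ℝ] S →ₗ[ℝ] ℝ := ∑ j, (triForm (k + 1)).compl₁₂ (pw j) (pw j)
  let B : S →ₗ[ℝ] S →ₗ[ℝ] ℝ := ∑ j, (triForm (k - 1)).compl₁₂ (pg j) (pg j) +
    ∑ i, (lineForm (k + 1)).compl₁₂ (pμ i) (pμ i)
  have hA : ∀ d : S, A d d = ∑ j, triForm _ (d.1.2.2 j) (d.1.2.2 j) := fun d => by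
    simp [A, pw]
  have hB : ∀ d : S, B d d = ∑ j, triForm _ (d.1.1 j) (d.1.1 j) +
      ∑ i, lineForm _ (d.1.2.1 i) (d.1.2.1 i) := fun d => by
    simp [B, pg, pμ, LinearMap.sum_apply]
  have hA0 : ∀ d : S, 0 ≤ A d d := fun d => by
    rw [hA]
    exact Finset.sum_nonneg fun j _ => triForm_self_nonneg _
  have hB0 : ∀ d : S, 0 ≤ B d d := fun d => by
    rw [hB]
    exact add_nonneg (Finset.sum_nonneg fun j _ => triForm_self_nonneg _)
      (Finset.sum_nonneg fun j _ => lineForm_self_nonneg _)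
  have hA1 : ∀ d : S, A d d = 0 → d.1.2.2 = 0 := fun d h => by
    rw [hA, Finset.sum_eq_zero_iff_of_nonneg fun j _ => triForm_self_nonneg _] at h
    exact funext fun j => triForm_definite (h j (Finset.mem_univ j))
  have hApos : ∀ d : S, d ≠ 0 → 0 < A d d := fun d hd => by
    refine lt_of_le_of_ne (hA0 d) fun h => hd ?_
    have h1 := hA1 d h.symm
    have h2 := refSpace_data_eq_zero hk d.2 h1
    exact Subtype.ext (Prod.ext h2.1 (Prod.ext h2.2 h1))
  have hBpos : ∀ d : S, d ≠ 0 → 0 < B d d := fun d hd => by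
    refine lt_of_le_of_ne (hB0 d) fun h => hd ?_
    have h := h.symm
    rw [hB, add_eq_zero_iff_of_nonneg (Finset.sum_nonneg fun j _ => triForm_self_nonneg _)
      (Finset.sum_nonneg fun j _ => lineForm_self_nonneg _),
      Finset.sum_eq_zero_iff_of_nonneg fun j _ => triForm_self_nonneg _,
      Finset.sum_eq_zero_iff_of_nonneg fun j _ => lineForm_self_nonneg _] at h
    have h1 : d.1.1 = 0 := funext fun j => triForm_definite (h.1 j (Finset.mem_univ j))
    have h2 : d.1.2.1 = 0 := funext fun j => lineForm_definite (h.2 j (Finset.mem_univ j))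
    -- With `g = 0` and `μ = 0`, testing the equation with `w` itself gives `‖w‖² = 0`.
    have h3 := d.2 d.1.2.2
    rw [h1, h2] at h3
    simp only [Pi.zero_apply, map_zero, LinearMap.zero_apply, Finset.sum_const_zero,
      sub_zero, ← hA] at h3
    exact Subtype.ext (Prod.ext h1 (Prod.ext h2 (hA1 d h3)))
  obtain ⟨C₁, hC₁, h₁⟩ := exists_form_le (E := S) A B hBpos
  obtain ⟨C₂, hC₂, h₂⟩ := exists_form_le (E := S) B A hApos
  refine ⟨max C₁ C₂, by positivity, fun g μ w h => ?_⟩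
  let d : S := ⟨(g, μ, w), fun q => by
    simpa only [triForm_apply, lineForm_apply, normalTrace_apply, Submodule.coe_inclusion] using h q⟩
  have hA' : A d d = ∑ j, ∫ x in refTriangle, (w j : Plane → ℝ) x * (w j : Plane → ℝ) x := hA d
  have hB' : B d d = ∑ j, (∫ x in refTriangle, (g j : Plane → ℝ) x * (g j : Plane → ℝ) x) +
            ∑ i, ∫ s in (0 : ℝ)..1, (μ i : ℝ → ℝ) s * (μ i : ℝ → ℝ) s := by
    rw [hB]
    simp only [lineForm_apply]
    rfl
  rw [← hA', ← hB']
  exact ⟨(h₁ d).trans (mul_le_mul_of_nonneg_right (le_max_left _ _) (hB0 d)),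
    (h₂ d).trans (mul_le_mul_of_nonneg_right (le_max_right _ _) (hA0 d))⟩

/-! ### Pulling the weak gradient back to the standard triangle -/

lemma edgeIntegral_eq (T : Affine.Triangle ℝ Plane) (i : Fin 3) (f : Plane → ℝ) :
    ∫ x : edge T i, f x ∂(arcLength (edge T i)) =
      dist (T.points (i + 1)) (T.points (i + 2)) *
        ∫ s in (0 : ℝ)..1, f (chart T (refEdge i s)) := by
  simp only [chart_refEdge]
  exact setIntegral_segment (edge_endpoints_ne T i) f

lemma comp_chart_mem_polyFun {m : ℕ} (T : Affine.Triangle ℝ Plane) (f : PolyFun m) :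
    (fun x => (f : Plane → ℝ) (chart T x)) ∈ PolyFun m :=
  comp_mem_polyFun f.2 (chart_mem_polyFun T)

/-- The covariant pullback of a vector field to the standard triangle. -/
def pullbackField {m : ℕ} (T : Affine.Triangle ℝ Plane) (w : VecPoly m) : VecPoly m := fun j =>
  ⟨fun x => ∑ l, (w l : Plane → ℝ) (chart T x) * side T j l, by
    have h := fun l => mul_mem_polyFun (comp_chart_mem_polyFun T (w l))
      (const_mem_polyFun 0 (side T j l))
    simp only [Fin.sum_univ_two]
    exact add_mem_polyFun (h 0) (h 1)⟩

/-- The contravariant push-forward of a vector field from the standard triangle. -/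
def pushField {m : ℕ} (T : Affine.Triangle ℝ Plane) (q : VecPoly m) : VecPoly m := fun l =>
  ⟨fun z => ∑ j, (q j : Plane → ℝ) (chartInv T z) * side T j l, by
    have h := fun j => mul_mem_polyFun (comp_mem_polyFun (q j).2 (chartInv_mem_polyFun T))
      (const_mem_polyFun 0 (side T j l))
    simp only [Fin.sum_univ_two]
    exact add_mem_polyFun (h 0) (h 1)⟩

lemma pushField_chart {m : ℕ} (T : Affine.Triangle ℝ Plane) (q : VecPoly m) (l : Fin 2)
    (x : Plane) : (pushField T q l : Plane → ℝ) (chart T x) =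
      ∑ j, (q j : Plane → ℝ) x * side T j l := by
  simp [pushField, chartInv_chart]

lemma polyFun_hasFDerivAt {m : ℕ} (f : PolyFun m) (x : Plane) :
    HasFDerivAt (f : Plane → ℝ) (fderiv ℝ (f : Plane → ℝ) x) x :=
  ((polyFun_contDiff f).differentiable (by simp) x).hasFDerivAt

lemma chartLin_single (T : Affine.Triangle ℝ Plane) (j : Fin 2) :
    chartLin T (EuclideanSpace.single j 1) = side T j := by
  fin_cases j <;> simp [chartLin]

lemma plane_eq_sum (v : Plane) : v = ∑ l, v l • EuclideanSpace.single l (1 : ℝ) := by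
  ext i; fin_cases i <;> simp [Fin.sum_univ_two]

lemma fderiv_comp_chart {m : ℕ} (T : Affine.Triangle ℝ Plane) (f : PolyFun m) (x : Plane)
    (j : Fin 2) :
    fderiv ℝ (fun x => (f : Plane → ℝ) (chart T x)) x (EuclideanSpace.single j 1) =
      ∑ l, fderiv ℝ (f : Plane → ℝ) (chart T x) (EuclideanSpace.single l 1) * side T j l := by
  have h := (polyFun_hasFDerivAt f (chart T x)).comp x (hasFDerivAt_chart T x)
  have h' : fderiv ℝ (fun x => (f : Plane → ℝ) (chart T x)) x = _ := h.fderiv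
  rw [h', ContinuousLinearMap.comp_apply, chartLin_single]
  nth_rewrite 1 [plane_eq_sum (side T j)]
  simp [mul_comm]

/-- By the chain rule the derivative matrices of the pushed field and of `q` are conjugate under the
linear part of the chart, so their traces agree. The usual factor `1 / jac T` is omitted from the
push-forward, hence none appears here. -/
lemma divergence_pushField {m : ℕ} (T : Affine.Triangle ℝ Plane) (q : VecPoly m) (x : Plane) :
    divergence (pushField T q) (chart T x) = divergence q x := by
  have key : ∀ l j, ∑ i, fderiv ℝ (pushField T q l : Plane → ℝ) (chart T x)
      (EuclideanSpace.single i 1) * side T j i =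
        ∑ n, fderiv ℝ (q n : Plane → ℝ) x (EuclideanSpace.single j 1) * side T n l := by
    intro l j
    rw [← fderiv_comp_chart]
    simp only [pushField_chart]
    have h : HasFDerivAt (fun x => ∑ n, (q n : Plane → ℝ) x * side T n l)
        (∑ n, side T n l • fderiv ℝ (q n : Plane → ℝ) x) x :=
      HasFDerivAt.fun_sum fun n _ => (polyFun_hasFDerivAt (q n) x).mul_const _
    rw [h.fderiv]
    simp [mul_comm]
  have hJ := jac_ne_zero T
  refine mul_right_cancel₀ hJ ?_
  simp only [divergence, jac, cross, Fin.sum_univ_two] at key ⊢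
  -- The coefficients are the cofactors of the matrix of sides.
  linear_combination side T 1 1 * key 0 0 - side T 0 1 * key 0 1 + side T 0 0 * key 1 1 -
    side T 1 0 * key 1 0

/-- Test with `pushField T q`. The pairing of covariant with contravariant fields is pointwise
invariant, the divergence is preserved and the edge flux scales by `|jac T|`; so does the area
element, and the common factor cancels. The functions `f i` extend the edge values to the plane so
that they can be composed with the chart. -/
lemma weakGradient_reference {m : ℕ} {T : Affine.Triangle ℝ Plane} {v₀ : Plane → ℝ}
    {vb : ∀ i, edge T i → ℝ} {f : Fin 3 → Plane → ℝ} (hf : ∀ i x, vb i x = f i x) {w : VecPoly m}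
    (hw : IsWeakGradient T v₀ vb w) (q : VecPoly m) :
    ∫ x in refTriangle, ∑ j, (pullbackField T w j : Plane → ℝ) x * (q j : Plane → ℝ) x =
      -(∫ x in refTriangle, v₀ (chart T x) * divergence q x) +
        ∑ i, ∫ s in (0 : ℝ)..1, f i (chart T (refEdge i s)) *
          refFlux i fun j => (q j : Plane → ℝ) (refEdge i s) := by
  have h := hw (pushField T q)
  rw [setIntegral_carrier, setIntegral_carrier] at h
  simp only [hf] at h
  have hb : ∀ i, ∫ x : edge T i, f i x * ∑ j, (pushField T q j : Plane → ℝ) x * normal T i j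
      ∂(arcLength (edge T i)) = |jac T| * ∫ s in (0 : ℝ)..1, f i (chart T (refEdge i s)) *
          refFlux i fun j => (q j : Plane → ℝ) (refEdge i s) := by
    intro i
    rw [edgeIntegral_eq T i fun x => f i x * ∑ j, (pushField T q j : Plane → ℝ) x * normal T i j,
      ← intervalIntegral.integral_const_mul, ← intervalIntegral.integral_const_mul]
    congr 1
    ext s
    rw [mul_left_comm, mul_left_comm |jac T|, ← dist_mul_flux]
    simp only [pushField_chart]
  simp only [hb, divergence_pushField, ← Finset.mul_sum] at h
  refine mul_left_cancel₀ (abs_jac_pos T).ne' ?_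
  rw [mul_add, mul_neg, ← h]
  congr 2
  ext x
  simp only [pushField_chart, pullbackField, Fin.sum_univ_two]
  ring

lemma refFlux_mul (i : Fin 3) (c : ℝ) (u : Fin 2 → ℝ) :
    refFlux i (fun j => c * u j) = c * refFlux i u := by
  fin_cases i <;> simp [refFlux]
  ring

lemma continuous_refFlux (i : Fin 3) {u : Fin 2 → ℝ → ℝ} (hu : ∀ j, Continuous (u j)) :
    Continuous fun s => refFlux i fun j => u j s := by
  have h0 := hu 0
  have h1 := hu 1
  fin_cases i <;> simp [refFlux] <;> fun_prop

/-- The divergence theorem for the field `u q`. -/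
lemma integral_by_parts {m n : ℕ} (u : PolyFun n) (q : VecPoly m) :
    ∑ j, (∫ x in refTriangle, fderiv ℝ (u : Plane → ℝ) x (EuclideanSpace.single j 1) *
        (q j : Plane → ℝ) x) + ∫ x in refTriangle, (u : Plane → ℝ) x * divergence q x =
      ∑ i, ∫ s in (0 : ℝ)..1, (u : Plane → ℝ) (refEdge i s) *
          refFlux i fun j => (q j : Plane → ℝ) (refEdge i s) := by
  have h := divergence_refTriangle (f := fun j x => (u : Plane → ℝ) x * (q j : Plane → ℝ) x)
    fun j => (polyFun_contDiff u).mul (polyFun_contDiff (q j))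
  simp only [refFlux_mul] at h
  rw [← h]
  have hi : ∀ {g : Plane → ℝ}, Continuous g → Integrable g (volume.restrict refTriangle) :=
    fun hg => hg.continuousOn.integrableOn_compact isCompact_refTriangle
  have hu := polyFun_continuous u
  have hd : ∀ j : Fin 2, Continuous fun x => fderiv ℝ (u : Plane → ℝ) x
      (EuclideanSpace.single j 1) * (q j : Plane → ℝ) x := fun j =>
    (((polyFun_contDiff u).continuous_fderiv (by simp)).clm_apply continuous_const).mul
      (polyFun_continuous (q j))
  have hud : Continuous fun x => (u : Plane → ℝ) x * divergence q x :=
    hu.mul (continuous_divergence q)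
  rw [← integral_finsetSum _ fun j _ => hi (hd j),
    ← integral_add (hi (continuous_finsetSum _ fun j _ => hd j)) (hi hud)]
  congr 1
  ext x
  rw [divergence, Finset.mul_sum, ← Finset.sum_add_distrib]
  refine Finset.sum_congr rfl fun j _ => ?_
  have := ((polyFun_hasFDerivAt u x).fun_mul (polyFun_hasFDerivAt (q j) x)).fderiv
  rw [this]
  simp
  ring

/-- The gradient of the pullback of `v₀` to the standard triangle. -/
def refGrad {k : ℕ} (T : Affine.Triangle ℝ Plane) (v₀ : PolyFun k) : Fin 2 → PolyFun (k - 1) :=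
  fun j => ⟨_, fderiv_mem_polyFun (comp_chart_mem_polyFun T v₀) (EuclideanSpace.single j 1)⟩

/-- The pullback to the unit interval of the jump `v₀ - f` on an edge. -/
def refJump {k : ℕ} (T : Affine.Triangle ℝ Plane) (v₀ : PolyFun k) (f : Fin 3 → PolyFun (k + 1)) :
    Fin 3 → LinePoly (k + 1) := fun i =>
  ⟨fun s => (v₀ : Plane → ℝ) (chart T (refEdge i s)) -
      (f i : Plane → ℝ) (chart T (refEdge i s)), by
    obtain ⟨c, d, h⟩ := refEdge_eq i
    exact comp_line_mem_linePoly (sub_mem_polyFun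
      (polyFun_mono (Nat.le_succ k) (comp_chart_mem_polyFun T v₀))
      (comp_chart_mem_polyFun T (f i))) (refEdge i) c d h⟩

lemma reference_problem {k : ℕ} {T : Affine.Triangle ℝ Plane} {v₀ : PolyFun k}
    {vb : ∀ i, edge T i → ℝ} {f : Fin 3 → PolyFun (k + 1)}
    (hf : ∀ i x, vb i x = (f i : Plane → ℝ) x) {w : VecPoly (k + 1)}
    (hw : IsWeakGradient T (v₀ : Plane → ℝ) vb w) (q : VecPoly (k + 1)) :
    ∑ j, ∫ x in refTriangle, (pullbackField T w j : Plane → ℝ) x * (q j : Plane → ℝ) x =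
      ∑ j, (∫ x in refTriangle, (refGrad T v₀ j : Plane → ℝ) x * (q j : Plane → ℝ) x) -
        ∑ i, ∫ s in (0 : ℝ)..1,
          (refJump T v₀ f i : ℝ → ℝ) s * refFlux i fun j => (q j : Plane → ℝ) (refEdge i s) := by
  have h1 := weakGradient_reference (f := fun i => f i) hf hw q
  have h2 := integral_by_parts ⟨_, comp_chart_mem_polyFun T v₀⟩ q
  have hwq : ∀ j, Continuous fun x =>
      (pullbackField T w j : Plane → ℝ) x * (q j : Plane → ℝ) x := fun j =>
    (polyFun_continuous (pullbackField T w j)).mul (polyFun_continuous (q j))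
  rw [integral_finsetSum _ fun j _ =>
    (hwq j).continuousOn.integrableOn_compact isCompact_refTriangle] at h1
  have h3 : ∀ i, ∫ s in (0 : ℝ)..1,
          (refJump T v₀ f i : ℝ → ℝ) s * refFlux i (fun j => (q j : Plane → ℝ) (refEdge i s)) =
      (∫ s in (0 : ℝ)..1, (v₀ : Plane → ℝ) (chart T (refEdge i s)) *
          refFlux i fun j => (q j : Plane → ℝ) (refEdge i s)) -
      ∫ s in (0 : ℝ)..1, (f i : Plane → ℝ) (chart T (refEdge i s)) *
          refFlux i fun j => (q j : Plane → ℝ) (refEdge i s) := by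
    intro i
    have hp : Continuous fun s => chart T (refEdge i s) :=
      (continuous_chart T).comp (continuous_refEdge i)
    have hr : Continuous fun s => refFlux i fun j => (q j : Plane → ℝ) (refEdge i s) :=
      continuous_refFlux i fun j => (polyFun_continuous (q j)).comp (continuous_refEdge i)
    have hv : Continuous fun s => (v₀ : Plane → ℝ) (chart T (refEdge i s)) *
        refFlux i fun j => (q j : Plane → ℝ) (refEdge i s) :=
      ((polyFun_continuous v₀).comp hp).mul hr
    have hfi : Continuous fun s => (f i : Plane → ℝ) (chart T (refEdge i s)) *
        refFlux i fun j => (q j : Plane → ℝ) (refEdge i s) :=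
      ((polyFun_continuous (f i)).comp hp).mul hr
    rw [← intervalIntegral.integral_sub (hv.intervalIntegrable _ _) (hfi.intervalIntegrable _ _)]
    congr 1
    ext s
    simp only [refJump]
    ring
  simp only [h3, Finset.sum_sub_distrib]
  simp only [refGrad] at h2 ⊢
  linarith

/-! ### The local norm equivalence -/

lemma norm_gradient_sq {m : ℕ} (v : PolyFun m) (x : Plane) :
    ‖gradient (v : Plane → ℝ) x‖ ^ 2 =
      ∑ l, fderiv ℝ (v : Plane → ℝ) x (EuclideanSpace.single l 1) ^ 2 := by
  rw [EuclideanSpace.real_norm_sq_eq]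
  refine Finset.sum_congr rfl fun l _ => ?_
  have : fderiv ℝ (v : Plane → ℝ) x (EuclideanSpace.single l 1) = gradient (v : Plane → ℝ) x l := by
    have h := InnerProductSpace.toDual_symm_apply (𝕜 := ℝ) (x := EuclideanSpace.single l (1 : ℝ))
      (y := fderiv ℝ (v : Plane → ℝ) x)
    rw [real_inner_plane, Finset.sum_eq_single l (by simp +contextual) (by simp)] at h
    rw [← h, gradient]
    simp
  rw [this]

/-- Pulling back costs a squared length `h_T²`, while the area element contributes `|jac T|`; in the
plane these are comparable through `K`, and no power of `h_T` is left over. -/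
lemma pullback_integral_le (T : Affine.Triangle ℝ Plane) {K : ℝ}
    (hK : Metric.diam (carrier T) ^ 2 ≤ K * |jac T|) {w : Fin 2 → Plane → ℝ}
    (hw : ∀ l, Continuous (w l)) :
    ∑ j, (∫ x in refTriangle, (∑ l, w l (chart T x) * side T j l) *
        (∑ l, w l (chart T x) * side T j l)) ≤ 2 * K * ∫ x in carrier T, ∑ l, w l x ^ 2 ∧
    ∫ x in carrier T, ∑ l, w l x ^ 2 ≤
      2 * K * ∑ j, (∫ x in refTriangle, (∑ l, w l (chart T x) * side T j l) *
        (∑ l, w l (chart T x) * side T j l)) := by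
  have hJ := abs_jac_pos T
  have hi : ∀ {g : Plane → ℝ}, Continuous g → Integrable g (volume.restrict refTriangle) :=
    fun hg => hg.continuousOn.integrableOn_compact isCompact_refTriangle
  have hwc : ∀ l, Continuous fun x => w l (chart T x) := fun l => (hw l).comp (continuous_chart T)
  have hpc : ∀ j, Continuous fun x => (∑ l, w l (chart T x) * side T j l) *
      (∑ l, w l (chart T x) * side T j l) := fun j => by
    have : Continuous fun x => ∑ l, w l (chart T x) * side T j l :=
      continuous_finsetSum _ fun l _ => (hwc l).mul continuous_const
    exact this.mul this
  have hs : Continuous fun x => ∑ l, w l (chart T x) ^ 2 :=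
    continuous_finsetSum _ fun l _ => (hwc l).pow 2
  rw [setIntegral_carrier, ← integral_finsetSum _ fun j _ => hi (hpc j)]
  have hi1 := hi hs
  have hi2 := hi (continuous_finsetSum Finset.univ fun j _ => hpc j)
  set N := ∫ x in refTriangle, ∑ l, w l (chart T x) ^ 2
  have hN : 0 ≤ N := integral_nonneg fun x => Finset.sum_nonneg fun l _ => sq_nonneg _
  set M := ∫ x in refTriangle, ∑ j, (∑ l, w l (chart T x) * side T j l) *
      (∑ l, w l (chart T x) * side T j l)
  have hM : 0 ≤ M := integral_nonneg fun x => Finset.sum_nonneg fun l _ => mul_self_nonneg _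
  have h1 : M ≤ 2 * Metric.diam (carrier T) ^ 2 * N := by
    rw [← integral_const_mul]
    refine integral_mono hi2 (hi1.const_mul _) fun x => ?_
    simpa only [← sq] using pullback_sq_le T fun l => w l (chart T x)
  have h2 : |jac T| ^ 2 * N ≤ 2 * Metric.diam (carrier T) ^ 2 * M := by
    rw [← integral_const_mul, ← integral_const_mul]
    refine integral_mono (hi1.const_mul _) (hi2.const_mul _) fun x => ?_
    simpa only [← sq] using sq_le_pullback T fun l => w l (chart T x)
  constructor
  · have := mul_le_mul_of_nonneg_right hK hN
    linarith
  · refine le_of_mul_le_mul_left ?_ hJ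
    have := mul_le_mul_of_nonneg_right hK hM
    linarith

theorem exists_local_equivalence {k : ℕ} (hk : 1 ≤ k) : ∃ C : ℝ, 0 < C ∧
    ∀ (K : ℝ) (T : Affine.Triangle ℝ Plane) (v₀ : PolyFun k) (vb : ∀ i, edge T i → ℝ)
      (w : VecPoly (k + 1)), Metric.diam (carrier T) ^ 2 ≤ K * |jac T| →
      (∀ i, vb i ∈ PolyOn (k + 1) (edge T i)) → IsWeakGradient T (v₀ : Plane → ℝ) vb w →
      (∫ x in carrier T, ∑ j, (w j : Plane → ℝ) x ^ 2) ≤ C * K ^ 2 *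
        ((∫ x in carrier T, ‖gradient (v₀ : Plane → ℝ) x‖ ^ 2) + (Metric.diam (carrier T))⁻¹ *
          ∑ i, ∫ x : edge T i, ((v₀ : Plane → ℝ) x - vb i x) ^ 2 ∂(arcLength (edge T i))) ∧
      (∫ x in carrier T, ‖gradient (v₀ : Plane → ℝ) x‖ ^ 2) + (Metric.diam (carrier T))⁻¹ *
          ∑ i, ∫ x : edge T i, ((v₀ : Plane → ℝ) x - vb i x) ^ 2 ∂(arcLength (edge T i)) ≤
        C * K ^ 2 * ∫ x in carrier T, ∑ j, (w j : Plane → ℝ) x ^ 2 := by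
  obtain ⟨C, hC, hC'⟩ := exists_reference_equivalence hk
  refine ⟨4 * C, by positivity, fun K T v₀ vb w hK hvb hw => ?_⟩
  have hJ := abs_jac_pos T
  have hh := diam_pos T
  -- Since `|jac T| ≤ h_T² ≤ K |jac T|`. This allows a jump factor `1` or `K` to be absorbed into
  -- the factor `2 K` of the gradient terms.
  have hK1 : 1 ≤ K := by
    have := (abs_jac_le T).trans hK
    by_contra! h
    nlinarith
  have hf : ∀ i, ∃ f : PolyFun (k + 1), ∀ x, vb i x = (f : Plane → ℝ) x := fun i => by
    obtain ⟨f, hf, hfv⟩ := hvb i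
    exact ⟨⟨f, hf⟩, fun x => (congrFun hfv x).symm⟩
  choose f hf using hf
  obtain ⟨r1, r2⟩ := hC' _ _ _ (reference_problem hf hw)
  obtain ⟨w1, w2⟩ := pullback_integral_le T hK fun l => polyFun_continuous (w l)
  obtain ⟨g1, g2⟩ := pullback_integral_le T hK
    (w := fun l x => fderiv ℝ (v₀ : Plane → ℝ) x (EuclideanSpace.single l 1)) fun l =>
      ((polyFun_contDiff v₀).continuous_fderiv (by simp)).clm_apply continuous_const
  simp only [← fderiv_comp_chart, ← norm_gradient_sq] at g1 g2
  have hb : ∀ i, ∫ x : edge T i, ((v₀ : Plane → ℝ) x - vb i x) ^ 2 ∂(arcLength (edge T i)) =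
      dist (T.points (i + 1)) (T.points (i + 2)) *
        ∫ s in (0 : ℝ)..1, (refJump T v₀ f i : ℝ → ℝ) s * (refJump T v₀ f i : ℝ → ℝ) s := by
    intro i
    simp only [hf]
    rw [edgeIntegral_eq T i fun x => ((v₀ : Plane → ℝ) x - (f i : Plane → ℝ) x) ^ 2]
    simp only [refJump, sq]
  simp only [hb, Finset.mul_sum]
  have hM0 : ∀ i, 0 ≤ ∫ s in (0 : ℝ)..1,
      (refJump T v₀ f i : ℝ → ℝ) s * (refJump T v₀ f i : ℝ → ℝ) s := fun i =>
    intervalIntegral.integral_nonneg zero_le_one fun s _ => mul_self_nonneg _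
  have b1 : ∑ i, (Metric.diam (carrier T))⁻¹ * (dist (T.points (i + 1)) (T.points (i + 2)) *
        ∫ s in (0 : ℝ)..1, (refJump T v₀ f i : ℝ → ℝ) s * (refJump T v₀ f i : ℝ → ℝ) s) ≤
      ∑ i, ∫ s in (0 : ℝ)..1, (refJump T v₀ f i : ℝ → ℝ) s * (refJump T v₀ f i : ℝ → ℝ) s := by
    refine Finset.sum_le_sum fun i _ => ?_
    rw [inv_mul_le_iff₀ hh]
    exact mul_le_mul_of_nonneg_right (dist_points_le_diam T _ _) (hM0 i)
  have b2 : ∑ i, ∫ s in (0 : ℝ)..1, (refJump T v₀ f i : ℝ → ℝ) s * (refJump T v₀ f i : ℝ → ℝ) s ≤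
      K * ∑ i, (Metric.diam (carrier T))⁻¹ * (dist (T.points (i + 1)) (T.points (i + 2)) *
        ∫ s in (0 : ℝ)..1, (refJump T v₀ f i : ℝ → ℝ) s * (refJump T v₀ f i : ℝ → ℝ) s) := by
    rw [Finset.mul_sum]
    refine Finset.sum_le_sum fun i _ => ?_
    have h1 : Metric.diam (carrier T) ≤ K * dist (T.points (i + 1)) (T.points (i + 2)) := by
      have := abs_jac_le_dist_mul T i
      refine le_of_mul_le_mul_right ?_ hh
      nlinarith
    rw [mul_left_comm, ← mul_assoc K]
    rw [le_inv_mul_iff₀ hh]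
    exact mul_le_mul_of_nonneg_right h1 (hM0 i)
  have hG0 : 0 ≤ ∫ x in carrier T, ‖gradient (v₀ : Plane → ℝ) x‖ ^ 2 :=
    integral_nonneg fun x => sq_nonneg _
  have hB0 : 0 ≤ ∑ i, (Metric.diam (carrier T))⁻¹ * (dist (T.points (i + 1)) (T.points (i + 2)) *
        ∫ s in (0 : ℝ)..1, (refJump T v₀ f i : ℝ → ℝ) s * (refJump T v₀ f i : ℝ → ℝ) s) :=
    Finset.sum_nonneg fun i _ => mul_nonneg (inv_nonneg.2 hh.le) (mul_nonneg dist_nonneg (hM0 i))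
  simp only [pullbackField, refGrad] at r1 r2
  generalize (∑ i, (Metric.diam (carrier T))⁻¹ * (dist (T.points (i + 1)) (T.points (i + 2)) *
        ∫ s in (0 : ℝ)..1, (refJump T v₀ f i : ℝ → ℝ) s * (refJump T v₀ f i : ℝ → ℝ) s)) = B at *
  generalize (∑ i, ∫ s in (0 : ℝ)..1,
    (refJump T v₀ f i : ℝ → ℝ) s * (refJump T v₀ f i : ℝ → ℝ) s) = M at *
  generalize (∫ x in carrier T, ‖gradient (v₀ : Plane → ℝ) x‖ ^ 2) = G at *
  generalize (∫ x in carrier T, ∑ j, (w j : Plane → ℝ) x ^ 2) = W at *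
  generalize (∑ j, (∫ x in refTriangle, (∑ l, (w l : Plane → ℝ) (chart T x) * side T j l) *
        (∑ l, (w l : Plane → ℝ) (chart T x) * side T j l))) = W' at *
  generalize (∑ j, (∫ x in refTriangle,
    fderiv ℝ (fun x => (v₀ : Plane → ℝ) (chart T x)) x (EuclideanSpace.single j 1) *
    fderiv ℝ (fun x => (v₀ : Plane → ℝ) (chart T x)) x (EuclideanSpace.single j 1))) = G' at *
  have hK0 : 0 ≤ 2 * K := by linarith
  constructor
  -- One factor `2 K` comes from the data and one from the weak gradient, whence `4 C K²`.
  · have h1 : G' + M ≤ 2 * K * (G + B) := by nlinarith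
    calc W ≤ 2 * K * W' := w2
      _ ≤ 2 * K * (C * (2 * K * (G + B))) := by gcongr; exact r1.trans (by gcongr)
      _ = 4 * C * K ^ 2 * (G + B) := by ring
  · have hM : 0 ≤ M := hB0.trans b1
    have h1 : G + B ≤ 2 * K * (G' + M) := by nlinarith
    calc G + B ≤ 2 * K * (G' + M) := h1
      _ ≤ 2 * K * (C * (2 * K * W)) := by gcongr; exact r2.trans (by gcongr)
      _ = 4 * C * K ^ 2 * W := by ring

/-! ### The kernel of the local weak gradient -/

/-- Injectivity of the reference problem makes the pulled-back gradient and jumps vanish, so `v₀` is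
constant and each `v_b` agrees with it. -/
lemma weakGradient_kernel {k : ℕ} (hk : 1 ≤ k) {T : Affine.Triangle ℝ Plane} {v₀ : PolyFun k}
    {vb : ∀ i, edge T i → ℝ} (hvb : ∀ i, vb i ∈ PolyOn (k + 1) (edge T i))
    (hw : IsWeakGradient T (v₀ : Plane → ℝ) vb (0 : VecPoly (k + 1))) :
    ∃ c : ℝ, (∀ x, (v₀ : Plane → ℝ) x = c) ∧ ∀ i x, vb i x = c := by
  have hf : ∀ i, ∃ f : PolyFun (k + 1), ∀ x, vb i x = (f : Plane → ℝ) x := fun i => by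
    obtain ⟨f, hf, hfv⟩ := hvb i
    exact ⟨⟨f, hf⟩, fun x => (congrFun hfv x).symm⟩
  choose f hf using hf
  have hp : pullbackField T (0 : VecPoly (k + 1)) = 0 := by
    ext j x
    simp [pullbackField]
  have hd : (refGrad T v₀, refJump T v₀ f, (0 : VecPoly (k + 1))) ∈ refSpace k := fun q => by
    have h := reference_problem hf hw q
    rw [hp] at h
    simpa only [triForm_apply, lineForm_apply, normalTrace_apply, Submodule.coe_inclusion] using h
  obtain ⟨h1, h2⟩ := refSpace_data_eq_zero hk hd rfl
  simp only at h1 h2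
  have hc : ∀ x y, (v₀ : Plane → ℝ) (chart T x) = (v₀ : Plane → ℝ) (chart T y) := by
    let u : PolyFun k := ⟨_, comp_chart_mem_polyFun T v₀⟩
    refine is_const_of_fderiv_eq_zero (𝕜 := ℝ) (f := (u : Plane → ℝ))
      ((polyFun_contDiff u).differentiable (by simp)) fun x => ?_
    ext v
    rw [plane_eq_sum v]
    have : ∀ j, fderiv ℝ (u : Plane → ℝ) x (EuclideanSpace.single j 1) = 0 := fun j =>
      congrFun (congrArg Subtype.val (congrFun h1 j)) x
    simp [this]
  have hconst : ∀ x, (v₀ : Plane → ℝ) x = (v₀ : Plane → ℝ) (chart T 0) := fun x => by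
    rw [← chart_chartInv T x]
    exact hc _ _
  refine ⟨_, hconst, fun i x => ?_⟩
  obtain ⟨y, hy⟩ := x
  have hy' := hy
  rw [edge, segment_eq_image_lineMap] at hy'
  obtain ⟨s, -, hs⟩ := hy'
  have h3 : (v₀ : Plane → ℝ) (chart T (refEdge i s)) - (f i : Plane → ℝ) (chart T (refEdge i s)) = 0 :=
    congrFun (congrArg Subtype.val (congrFun h2 i)) s
  rw [chart_refEdge, hs] at h3
  rw [hf, ← hconst y]
  change (f i : Plane → ℝ) y = _
  linarith

/-! ### Neighbours in a triangulation -/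

/-- The vertices of a triangle as an affine basis of the plane. -/
def vertexBasis (T : Affine.Triangle ℝ Plane) : AffineBasis (Fin 3) ℝ Plane :=
  ⟨T.points, T.independent, by
    rw [T.independent.affineSpan_eq_top_iff_card_eq_finrank_add_one]
    simp⟩

lemma coord_points_self (T : Affine.Triangle ℝ Plane) (i : Fin 3) :
    (vertexBasis T).coord i (T.points i) = 1 := (vertexBasis T).coord_apply_eq i

lemma coord_points_ne (T : Affine.Triangle ℝ Plane) {i j : Fin 3} (h : i ≠ j) :
    (vertexBasis T).coord i (T.points j) = 0 := (vertexBasis T).coord_apply_ne h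

lemma mem_carrier_iff_coord (T : Affine.Triangle ℝ Plane) {z : Plane} :
    z ∈ carrier T ↔ ∀ i, 0 ≤ (vertexBasis T).coord i z := by
  have := (vertexBasis T).convexHull_eq_nonneg_coord
  change z ∈ convexHull ℝ (range (vertexBasis T)) ↔ _
  rw [this]
  rfl

lemma affineMap_eq_sum_coord (T : Affine.Triangle ℝ Plane) (f : Plane →ᵃ[ℝ] ℝ) (z : Plane) :
    f z = ∑ i, (vertexBasis T).coord i z * f (T.points i) := by
  have h1 := (vertexBasis T).linear_combination_coord_eq_self z
  have h2 := (vertexBasis T).sum_coord_apply_eq_one z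
  have hf : ∀ y, f y = f.linear y + f 0 := fun y => congrFun (AffineMap.decomp f) y
  calc f z = f.linear (∑ i, (vertexBasis T).coord i z • T.points i) + f 0 := by
        rw [hf z]; congr 2; exact h1.symm
    _ = ∑ i, (vertexBasis T).coord i z * f.linear (T.points i) + f 0 := by
        simp only [map_sum, map_smul, smul_eq_mul]
    _ = ∑ i, (vertexBasis T).coord i z * f (T.points i) := by
        simp only [hf (T.points _), mul_add, Finset.sum_add_distrib, ← Finset.sum_mul, h2, one_mul]

lemma le_of_mem_convexHull (f : Plane →ᵃ[ℝ] ℝ) {c : ℝ} {s : Set Plane} (h : ∀ p ∈ s, f p ≤ c)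
    {z : Plane} (hz : z ∈ convexHull ℝ s) : f z ≤ c :=
  convexHull_min (t := f ⁻¹' Iic c) h ((convex_Iic c).affine_preimage f) hz

lemma coord_lineMap (T : Affine.Triangle ℝ Plane) (i : Fin 3) (p q : Plane) (s : ℝ) :
    (vertexBasis T).coord i (AffineMap.lineMap p q s) =
      (1 - s) * (vertexBasis T).coord i p + s * (vertexBasis T).coord i q := by
  rw [AffineMap.apply_lineMap, AffineMap.lineMap_apply_module]
  simp

lemma edge_subset_carrier (T : Affine.Triangle ℝ Plane) (i : Fin 3) : edge T i ⊆ carrier T :=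
  (convex_convexHull ℝ _).segment_subset (subset_convexHull ℝ _ (mem_range_self _))
    (subset_convexHull ℝ _ (mem_range_self _))

lemma exists_edge_of_vertices (T : Affine.Triangle ℝ Plane) {m n : Fin 3} (h : m ≠ n) :
    ∃ i, edge T i = segment ℝ (T.points m) (T.points n) ∧ i ≠ m ∧ i ≠ n ∧
      ∀ j, j = i ∨ j = m ∨ j = n := by
  have key : ∀ m n : Fin 3, m ≠ n → ∃ i, ((i + 1 = m ∧ i + 2 = n) ∨ (i + 1 = n ∧ i + 2 = m)) ∧
      i ≠ m ∧ i ≠ n ∧ ∀ j, j = i ∨ j = m ∨ j = n := by decide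
  obtain ⟨i, h1, h2⟩ := key m n h
  refine ⟨i, ?_, h2⟩
  rcases h1 with ⟨h3, h4⟩ | ⟨h3, h4⟩
  · rw [edge, h3, h4]
  · rw [edge, h3, h4, segment_symm]

/-- Such an edge has a relative interior point in `Ω`, and the covering provides a triangle across
the edge at that point. Conformity forces this triangle to have both endpoints as vertices, so it
adjoins the whole edge and not just one point of it. -/
lemma exists_neighbour {Ω : Set Plane} (hΩ : IsOpen Ω) (𝒯 : Triangulation Ω)
    {T : Affine.Triangle ℝ Plane} (hT : T ∈ 𝒯.elements) (i : Fin 3)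
    (hi : ¬ edge T i ⊆ frontier Ω) :
    ∃ T' ∈ 𝒯.elements, ∃ i', edge T' i' = edge T i ∧
      ∀ y ∈ edge T i, y ≠ T.points (i + 1) → y ≠ T.points (i + 2) →
        carrier T ∪ carrier T' ∈ nhds y := by
  have idx : i ≠ i + 1 ∧ i ≠ i + 2 ∧ i + 1 ≠ i + 2 ∧ ∀ j, j = i ∨ j = i + 1 ∨ j = i + 2 := by
    clear hi
    revert i; decide
  obtain ⟨ne1, ne2, ne12, hall⟩ := idx
  set a := T.points (i + 1) with ha
  set b := T.points (i + 2) with hb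
  set l := fun j => (vertexBasis T).coord j with hl
  have lcont : ∀ j, Continuous (l j) := fun j => continuous_barycentric_coord _ j
  have lline : ∀ j p q r, l j (AffineMap.lineMap p q r) = (1 - r) * l j p + r * l j q :=
    coord_lineMap T
  have la : l i a = 0 := coord_points_ne T ne1
  have lb : l i b = 0 := coord_points_ne T ne2
  have la1 : l (i + 1) a = 1 := coord_points_self T _
  have lb1 : l (i + 1) b = 0 := coord_points_ne T ne12
  have la2 : l (i + 2) a = 0 := coord_points_ne T ne12.symm
  have lb2 : l (i + 2) b = 1 := coord_points_self T _
  have hsub : carrier T ⊆ closure Ω := by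
    rw [← 𝒯.cover]
    exact subset_biUnion_of_mem (u := fun T => carrier T) hT
  -- The given point of the edge off the frontier may be a vertex; as `Ω` is open, it can be moved
  -- into the open edge.
  obtain ⟨s, hs, hsΩ⟩ : ∃ s ∈ Ioo (0 : ℝ) 1, AffineMap.lineMap a b s ∈ Ω := by
    obtain ⟨x₀, hx₀, hx₀'⟩ := not_subset.1 hi
    have hx₀Ω : x₀ ∈ Ω := by
      by_contra h
      exact hx₀' (by rw [hΩ.frontier_eq]; exact ⟨hsub (edge_subset_carrier T i hx₀), h⟩)
    rw [edge, segment_eq_image_lineMap] at hx₀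
    obtain ⟨s₀, hs₀, rfl⟩ := hx₀
    have ho : IsOpen ((fun s : ℝ => (AffineMap.lineMap a b s : Plane)) ⁻¹' Ω) :=
      hΩ.preimage AffineMap.lineMap_continuous
    rw [← closure_Ioo zero_ne_one] at hs₀
    obtain ⟨s, h1, h2⟩ := mem_closure_iff.1 hs₀ _ ho hx₀Ω
    exact ⟨s, h2, h1⟩
  set x : Plane := AffineMap.lineMap a b s with hx
  have lxi : l i x = 0 := by rw [hx, lline, la, lb]; ring
  have lx1 : 0 < l (i + 1) x := by rw [hx, lline, la1, lb1]; linarith [hs.2]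
  have lx2 : 0 < l (i + 2) x := by rw [hx, lline, la2, lb2]; linarith [hs.1]
  -- Approach `x` along the line from the opposite vertex, from beyond the edge.
  have hxcl : x ∈ closure (Ω ∩ {z | l i z < 0}) := by
    have ht : Filter.Tendsto (fun r : ℝ => (AffineMap.lineMap (T.points i) x r : Plane))
        (nhdsWithin 1 (Ioi 1)) (nhds x) := by
      have hcont : Continuous (fun r : ℝ => (AffineMap.lineMap (T.points i) x r : Plane)) :=
        AffineMap.lineMap_continuous
      have := hcont.tendsto 1
      rw [AffineMap.lineMap_apply_one] at this
      exact this.mono_left nhdsWithin_le_nhds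
    refine mem_closure_of_tendsto ht ?_
    filter_upwards [ht (hΩ.mem_nhds hsΩ), self_mem_nhdsWithin] with r h1 h2
    refine ⟨h1, ?_⟩
    have h3 : l i (T.points i) = 1 := coord_points_self T i
    have h4 : (1 : ℝ) < r := h2
    change l i _ < 0
    rw [lline, h3, lxi]
    linarith
  have hcov : Ω ∩ {z | l i z < 0} ⊆ ⋃ T' ∈ 𝒯.elements, carrier T' ∩ {z | l i z < 0} := by
    rintro z ⟨hz, hz'⟩
    have := subset_closure hz
    rw [← 𝒯.cover] at this
    simp only [mem_iUnion] at this ⊢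
    obtain ⟨T', hT', h⟩ := this
    exact ⟨T', hT', h, hz'⟩
  have hxcl' := closure_mono hcov hxcl
  -- Finiteness selects a single triangle that reaches `x` from the far side.
  rw [Finset.closure_biUnion] at hxcl'
  simp only [mem_iUnion] at hxcl'
  obtain ⟨T', hT', hxT'⟩ := hxcl'
  obtain ⟨z₀, hz₀, hz₀'⟩ : (carrier T' ∩ {z | l i z < 0}).Nonempty := closure_nonempty_iff.1 ⟨x, hxT'⟩
  have hxT'' : x ∈ carrier T' := by
    have := closure_mono inter_subset_left hxT'
    rwa [(isCompact_carrier T').isClosed.closure_eq] at this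
  have hne : T ≠ T' := by
    rintro rfl
    exact absurd ((mem_carrier_iff_coord T).1 hz₀ i) (not_le.2 hz₀')
  have hxT : x ∈ carrier T := edge_subset_carrier T i (by
    rw [edge, segment_eq_image_lineMap]
    exact ⟨s, Ioo_subset_Icc_self hs, rfl⟩)
  have hcommon : x ∈ convexHull ℝ (range T.points ∩ range T'.points) := by
    rw [← 𝒯.inter_eq T hT T' hT' hne]
    exact ⟨hxT, hxT''⟩
  -- If vertex `j` were not shared, `l j` would vanish at all common vertices and so be at most zero
  -- at `x`.
  have hvert : ∀ j, 0 < l j x → T.points j ∈ range T'.points := by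
    intro j hj
    by_contra hcon
    refine absurd hj (not_lt.2 (le_of_mem_convexHull (l j) ?_ hcommon))
    rintro _ ⟨⟨n, rfl⟩, hn⟩
    have : j ≠ n := by rintro rfl; exact hcon hn
    exact (coord_points_ne T this).le
  obtain ⟨m, hm⟩ := hvert _ lx1
  obtain ⟨n, hn⟩ := hvert _ lx2
  have hmn : m ≠ n := by
    rintro rfl
    exact edge_endpoints_ne T i (hm.symm.trans hn)
  obtain ⟨i', he, hi'm, hi'n, hall'⟩ := exists_edge_of_vertices T' hmn
  refine ⟨T', hT', i', by rw [he, hm, hn]; rfl, fun y hy hya hyb => ?_⟩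
  set l' := fun j => (vertexBasis T').coord j with hl'
  have lcont' : ∀ j, Continuous (l' j) := fun j => continuous_barycentric_coord _ j
  -- Both coordinates vanish on the line of the shared edge, so they are proportional; the factor is
  -- negative, which places `T'` opposite to `T`.
  have exp : ∀ z, l i z = l' i' z * l i (T'.points i') := by
    intro z
    have h := affineMap_eq_sum_coord T' (l i) z
    rw [h, Finset.sum_eq_single i' _ (by simp)]
    intro j _ hj
    rcases hall' j with rfl | rfl | rfl
    · exact absurd rfl hj
    · rw [hm]; change _ * l i a = 0; rw [la, mul_zero]
    · rw [hn]; change _ * l i b = 0; rw [lb, mul_zero]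
  have hneg : l i (T'.points i') < 0 := by
    by_contra! h
    have h1 := (mem_carrier_iff_coord T').1 hz₀ i'
    have h2 : l i z₀ < 0 := hz₀'
    rw [exp] at h2
    exact absurd (mul_nonneg h1 h) (not_le.2 h2)
  rw [edge, segment_eq_image_lineMap] at hy
  obtain ⟨r, hr, rfl⟩ := hy
  have hr0 : 0 < r := lt_of_le_of_ne hr.1 (by rintro rfl; simp [ha] at hya)
  have hr1 : r < 1 := lt_of_le_of_ne hr.2 (by rintro rfl; simp [hb] at hyb)
  set y : Plane := AffineMap.lineMap a b r
  have lma : l' m a = 1 := by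
    rw [ha, ← hm]
    exact coord_points_self T' m
  have lmb : l' m b = 0 := by
    rw [hb, ← hn]
    exact coord_points_ne T' hmn
  have lna : l' n a = 0 := by
    rw [ha, ← hm]
    exact coord_points_ne T' hmn.symm
  have lnb : l' n b = 1 := by
    rw [hb, ← hn]
    exact coord_points_self T' n
  have lline' : ∀ j p q r, l' j (AffineMap.lineMap p q r) = (1 - r) * l' j p + r * l' j q :=
    coord_lineMap T'
  have e1 : 0 < l (i + 1) y := by rw [lline, la1, lb1]; linarith
  have e2 : 0 < l (i + 2) y := by rw [lline, la2, lb2]; linarith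
  have e3 : 0 < l' m y := by rw [lline', lma, lmb]; linarith
  have e4 : 0 < l' n y := by rw [lline', lna, lnb]; linarith
  filter_upwards [(lcont _).tendsto y (Ioi_mem_nhds e1), (lcont _).tendsto y (Ioi_mem_nhds e2),
    (lcont' _).tendsto y (Ioi_mem_nhds e3), (lcont' _).tendsto y (Ioi_mem_nhds e4)] with z h1 h2 h3 h4
  -- Near `y` the other coordinates in both triangles stay positive, so the sign of `l i z` alone
  -- decides which triangle contains `z`.
  rcases le_or_gt 0 (l i z) with h | h
  · left
    refine (mem_carrier_iff_coord T).2 fun j => ?_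
    rcases hall j with rfl | rfl | rfl
    exacts [h, le_of_lt h1, le_of_lt h2]
  · right
    refine (mem_carrier_iff_coord T').2 fun j => ?_
    rcases hall' j with rfl | rfl | rfl
    · rw [exp] at h
      by_contra! h5
      exact absurd (mul_pos_of_neg_of_neg h5 hneg) (not_lt.2 h.le)
    exacts [le_of_lt h3, le_of_lt h4]

namespace Triangulation

variable {Ω : Set Plane} {𝒯 : Triangulation Ω} {k : ℕ}

/-! ### The energy seminorm -/

lemma weakGrad_unique {v : 𝒯.Vh k} {T : 𝒯.elements} {w : VecPoly (k + 1)}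
    (hw : IsWeakGradient (T : Affine.Triangle ℝ Plane) (interiorPart v T) (boundaryPart v T) w) :
    weakGrad v T = w :=
  (existsUnique_isWeakGradient (k + 1) T (interiorPart v T) (polyFun_continuous (v.1 T))
    (boundaryPart v T) (fun i => (polyOn_continuous (v.2 (𝒯.edgeOf T i))))).unique
    (isWeakGradient_weakGrad v T) hw

/-- `weakGrad` is a chosen solution, so linearity comes from uniqueness: the combination solves the
combined equation. -/
lemma weakGrad_lincomb (c : ℝ) (u v : 𝒯.Vh k) (T : 𝒯.elements) :
    weakGrad (c • u + v) T = c • weakGrad u T + weakGrad v T := by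
  refine weakGrad_unique fun q => ?_
  have hu := isWeakGradient_weakGrad u T q
  have hv := isWeakGradient_weakGrad v T q
  have hl : ipForm (k + 1) T (c • weakGrad u T + weakGrad v T) q =
      c * ipForm (k + 1) T (weakGrad u T) q + ipForm (k + 1) T (weakGrad v T) q := by simp
  refine hl.trans ?_
  change c * (∫ x in carrier (T : Affine.Triangle ℝ Plane), _) +
    (∫ x in carrier (T : Affine.Triangle ℝ Plane), _) = _
  rw [hu, hv]
  have hi : ∀ w : 𝒯.Vh k, Integrable (fun x => interiorPart w T x * divergence q x)
      (volume.restrict (carrier (T : Affine.Triangle ℝ Plane))) := fun w =>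
    integrableOn_carrier T ((polyFun_continuous (w.1 T)).mul (continuous_divergence q))
  have hb : ∀ (w : 𝒯.Vh k) i, Integrable (fun x : edge (T : Affine.Triangle ℝ Plane) i =>
      boundaryPart w T i x * ∑ j, (q j : Plane → ℝ) x * normal T i j) (arcLength (edge T i)) :=
    fun w i => integrable_edge T i ((polyOn_continuous (w.2 (𝒯.edgeOf T i))).mul
      (continuous_finsetSum _ fun j _ =>
        ((polyFun_continuous (q j)).comp continuous_subtype_val).mul continuous_const))
  have e1 : ∫ x in carrier (T : Affine.Triangle ℝ Plane),
      interiorPart (c • u + v) T x * divergence q x =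
      c * (∫ x in carrier (T : Affine.Triangle ℝ Plane), interiorPart u T x * divergence q x) +
      ∫ x in carrier (T : Affine.Triangle ℝ Plane), interiorPart v T x * divergence q x := by
    rw [← integral_const_mul, ← integral_add ((hi u).const_mul c) (hi v)]
    congr 1
    ext x
    simp [interiorPart]
    ring
  have e2 : ∀ i, ∫ x : edge (T : Affine.Triangle ℝ Plane) i,
      boundaryPart (c • u + v) T i x * ∑ j, (q j : Plane → ℝ) x * normal T i j
        ∂(arcLength (edge T i)) =
      c * (∫ x : edge (T : Affine.Triangle ℝ Plane) i,
        boundaryPart u T i x * ∑ j, (q j : Plane → ℝ) x * normal T i j ∂(arcLength (edge T i))) +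
      ∫ x : edge (T : Affine.Triangle ℝ Plane) i,
        boundaryPart v T i x * ∑ j, (q j : Plane → ℝ) x * normal T i j
          ∂(arcLength (edge T i)) := by
    intro i
    rw [← integral_const_mul, ← integral_add ((hb u i).const_mul c) (hb v i)]
    congr 1
    ext x
    have h : boundaryPart (c • u + v) T i x =
        c * boundaryPart u T i x + boundaryPart v T i x := rfl
    rw [h]
    ring
  simp only [e1, e2, Finset.sum_add_distrib, ← Finset.mul_sum]
  ring

/-- The weak gradient on an element as a linear map. -/
def weakGradLin (T : 𝒯.elements) : 𝒯.Vh k →ₗ[ℝ] VecPoly (k + 1) where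
  toFun v := weakGrad v T
  map_add' u v := by simpa using weakGrad_lincomb 1 u v T
  map_smul' c v := by
    have h0 : weakGrad (0 : 𝒯.Vh k) T = 0 := by simpa using weakGrad_lincomb 1 (0 : 𝒯.Vh k) 0 T
    simpa [h0] using weakGrad_lincomb c v 0 T

/-- The bilinear form of the energy seminorm. -/
def energyForm (𝒯 : Triangulation Ω) (k : ℕ) : 𝒯.Vh k →ₗ[ℝ] 𝒯.Vh k →ₗ[ℝ] ℝ :=
  ∑ T : 𝒯.elements, (ipForm (k + 1) T).compl₁₂ (weakGradLin T) (weakGradLin T)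

lemma energyForm_apply (u v : 𝒯.Vh k) :
    energyForm 𝒯 k u v = ∑ T : 𝒯.elements, ∫ x in carrier (T : Affine.Triangle ℝ Plane),
      ∑ j, (weakGrad u T j : Plane → ℝ) x * (weakGrad v T j : Plane → ℝ) x := by
  simp only [energyForm, LinearMap.sum_apply, LinearMap.compl₁₂_apply]
  rfl

lemma energyNorm_eq (v : 𝒯.Vh k) : energyNorm v = √(energyForm 𝒯 k v v) := by
  rw [energyForm_apply, energyNorm]
  simp only [sq]

end Triangulation

/-- The triangle inequality is Cauchy–Schwarz for a semidefinite form, supplied by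
`PreInnerProductSpace.Core`. -/
lemma exists_seminorm_of_form {E : Type*} [AddCommGroup E] [Module ℝ E] (B : E →ₗ[ℝ] E →ₗ[ℝ] ℝ)
    (hs : ∀ x y, B x y = B y x) (h0 : ∀ x, 0 ≤ B x x) :
    ∃ N : Seminorm ℝ E, ∀ x, N x = √(B x x) := by
  let c : PreInnerProductSpace.Core ℝ E :=
    { inner := fun x y => B x y
      conj_inner_symm := fun x y => by simpa using hs y x
      re_inner_nonneg := fun x => by simpa using h0 x
      add_left := fun x y z => by simp
      smul_left := fun x y r => by simp }
  let _ : SeminormedAddCommGroup E := InnerProductSpace.Core.toSeminormedAddCommGroup (c := c)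
  let _ : NormedSpace ℝ E := InnerProductSpace.Core.toNormedSpace (c := c)
  exact ⟨normSeminorm ℝ E, fun x => rfl⟩

/-! ### Definiteness of the energy seminorm on `V_h⁰`, and the shape regularity bound. -/

namespace Triangulation

variable {Ω : Set Plane} {𝒯 : Triangulation Ω} {k : ℕ}

lemma exists_local_constant (hk : 1 ≤ k) {v : 𝒯.Vh k} (hv : energyNorm v = 0) (T : 𝒯.elements) :
    ∃ c : ℝ, (∀ x, interiorPart v T x = c) ∧ ∀ i x, boundaryPart v T i x = c := by
  have hnn : ∀ T : 𝒯.elements, 0 ≤ ipForm (k + 1) T (weakGrad v T) (weakGrad v T) := fun T =>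
    integral_nonneg fun x => Finset.sum_nonneg fun j _ => mul_self_nonneg _
  have h1 : ∑ T : 𝒯.elements, ipForm (k + 1) T (weakGrad v T) (weakGrad v T) = 0 := by
    rw [energyNorm_eq, energyForm_apply] at hv
    exact (Real.sqrt_eq_zero (Finset.sum_nonneg fun T _ => hnn T)).1 hv
  have h2 := (Finset.sum_eq_zero_iff_of_nonneg fun T _ => hnn T).1 h1 T (Finset.mem_univ T)
  have h3 := isWeakGradient_weakGrad v T
  rw [ipForm_definite _ _ h2] at h3
  exact weakGradient_kernel hk (fun i => (v.2 (𝒯.edgeOf T i)).2) h3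

/-- The single-valuedness of `v_b`, which lets constants pass between neighbours. Its values live in
types depending on the edge, so the equality is transported through the bundled edges. -/
lemma boundaryPart_congr (v : 𝒯.Vh k) {T T' : 𝒯.elements} {i i' : Fin 3}
    (h : edge (T' : Affine.Triangle ℝ Plane) i' = edge (T : Affine.Triangle ℝ Plane) i) {y : Plane}
    (hy : y ∈ edge (T : Affine.Triangle ℝ Plane) i)
    (hy' : y ∈ edge (T' : Affine.Triangle ℝ Plane) i') :
    boundaryPart v T' i' ⟨y, hy'⟩ = boundaryPart v T i ⟨y, hy⟩ := by
  have key : ∀ e e' : 𝒯.edges, e' = e → ∀ (h : y ∈ (e : Set Plane)) (h' : y ∈ (e' : Set Plane)),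
      (v.2 e').1 ⟨y, h'⟩ = (v.2 e).1 ⟨y, h⟩ := by
    rintro e _ rfl _ _
    rfl
  exact key (𝒯.edgeOf T i) (𝒯.edgeOf T' i') (Subtype.ext h) hy hy'

/-- A connectedness argument in the plane minus the vertices, in place of following a chain of
triangles to the boundary; no boundary edge has to be exhibited. -/
lemma local_constant_eq_zero (hΩ : IsOpen Ω) {v : 𝒯.Vh k} (hv : v ∈ 𝒯.Vh0 k)
    {c : 𝒯.elements → ℝ} (hc : ∀ T i x, boundaryPart v T i x = c T) (T₀ : 𝒯.elements) :
    c T₀ = 0 := by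
  by_contra hne
  let S : Set 𝒯.elements := {T | c T = c T₀}
  let K : Set Plane := ⋃ T ∈ S, carrier (T : Affine.Triangle ℝ Plane)
  let V : Set Plane := ⋃ T : 𝒯.elements, range (T : Affine.Triangle ℝ Plane).points
  have hV : V.Finite := finite_iUnion fun T => finite_range _
  have hK : IsCompact K := S.toFinite.isCompact_biUnion fun T _ => isCompact_carrier _
  have hsub : ∀ T ∈ S, carrier (T : Affine.Triangle ℝ Plane) ⊆ K := fun T hT =>
    subset_biUnion_of_mem (u := fun T : 𝒯.elements => carrier (T : Affine.Triangle ℝ Plane)) hT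
  -- Away from the vertices, a point of `K` is inside a triangle or in the relative interior of an
  -- edge.
  have hlocal : K ∩ Vᶜ ⊆ interior K := by
    rintro y ⟨hy, hyV⟩
    simp only [K, mem_iUnion] at hy
    obtain ⟨T, hT, hyT⟩ := hy
    have hyne : ∀ (T : 𝒯.elements) j, y ≠ (T : Affine.Triangle ℝ Plane).points j := by
      rintro T j rfl
      exact hyV (mem_iUnion.2 ⟨T, mem_range_self j⟩)
    have hnn := (mem_carrier_iff_coord (T : Affine.Triangle ℝ Plane)).1 hyT
    by_cases hpos : ∀ j, 0 < (vertexBasis (T : Affine.Triangle ℝ Plane)).coord j y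
    · refine interior_mono (hsub T hT) ?_
      have := (vertexBasis (T : Affine.Triangle ℝ Plane)).interior_convexHull
      change y ∈ interior (convexHull ℝ (range (vertexBasis (T : Affine.Triangle ℝ Plane))))
      rw [this]
      exact hpos
    · push Not at hpos
      obtain ⟨i, hi⟩ := hpos
      have hi0 := le_antisymm hi (hnn i)
      have hye : y ∈ edge (T : Affine.Triangle ℝ Plane) i := by
        have h1 := (vertexBasis (T : Affine.Triangle ℝ Plane)).linear_combination_coord_eq_self y
        have h2 := (vertexBasis (T : Affine.Triangle ℝ Plane)).sum_coord_apply_eq_one y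
        have hs : ∀ {M : Type} [AddCommMonoid M] (f : Fin 3 → M),
            ∑ j, f j = f i + (f (i + 1) + f (i + 2)) := by
          intro M _ f
          have e1 : (1 : Fin 3) + 1 = 2 := rfl
          have e2 : (1 : Fin 3) + 2 = 0 := rfl
          have e3 : (2 : Fin 3) + 1 = 0 := rfl
          have e4 : (2 : Fin 3) + 2 = 1 := rfl
          fin_cases i <;> simp [Fin.sum_univ_three, e1, e2, e3, e4, add_assoc] <;> abel
        rw [hs, hi0, zero_smul, zero_add] at h1
        rw [hs, hi0, zero_add] at h2
        exact ⟨_, _, hnn _, hnn _, h2, h1⟩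
      -- On a boundary edge `v_b = 0` contradicts the nonzero constant; across any other edge the
      -- neighbour has the same constant and belongs to `S`.
      by_cases hfr : edge (T : Affine.Triangle ℝ Plane) i ⊆ frontier Ω
      · have h1 := hv (𝒯.edgeOf T i) hfr
        have h2 : boundaryPart v T i ⟨y, hye⟩ = 0 :=
          congrFun (congrArg Subtype.val h1) ⟨y, hye⟩
        rw [hc] at h2
        exact absurd (hT.symm.trans h2) hne
      · obtain ⟨T', hT', i', he, hnb⟩ := exists_neighbour hΩ 𝒯 T.2 i hfr
        have hT'S : (⟨T', hT'⟩ : 𝒯.elements) ∈ S := by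
          have hye' : y ∈ edge T' i' := he ▸ hye
          have h1 := boundaryPart_congr v (T := T) (T' := ⟨T', hT'⟩) he hye hye'
          rw [hc, hc] at h1
          exact h1.trans hT
        exact mem_interior_iff_mem_nhds.2 (Filter.mem_of_superset
          (hnb y hye (hyne T _) (hyne T _)) (union_subset (hsub T hT) (hsub _ hT'S)))
  have hdense : Dense Vᶜ := hV.countable.dense_compl ℝ
  -- Removing finitely many points does not disconnect a space of dimension two; on this set
  -- `interior K` is relatively open and closed.
  have hconn : IsPreconnected Vᶜ :=
    (hV.countable.isConnected_compl_of_one_lt_rank (by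
      rw [← Module.finrank_eq_rank]; simp)).isPreconnected
  have hVK : Vᶜ ⊆ interior K := by
    refine hconn.subset_of_closure_inter_subset isOpen_interior ?_ ?_
    · have h1 : (interior K).Nonempty :=
        (interior_carrier_nonempty (T₀ : Affine.Triangle ℝ Plane)).mono
          (interior_mono (hsub T₀ rfl))
      rw [inter_comm]
      exact hdense.inter_open_nonempty _ isOpen_interior h1
    · refine Subset.trans (inter_subset_inter_left _ ?_) hlocal
      exact closure_minimal interior_subset hK.isClosed
  have huniv : K = univ := by
    rw [← univ_subset_iff, ← hdense.closure_eq]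
    exact closure_minimal (hVK.trans interior_subset) hK.isClosed
  exact noncompact_univ Plane (huniv ▸ hK)

lemma eq_zero_of_energyNorm_eq_zero (hk : 1 ≤ k) (hΩ : IsOpen Ω) {v : 𝒯.Vh k} (hv : v ∈ 𝒯.Vh0 k)
    (h : energyNorm v = 0) : v = 0 := by
  choose c hc hc' using exists_local_constant hk h
  have h0 := local_constant_eq_zero hΩ hv hc'
  refine Prod.ext (funext fun T => Subtype.ext (funext fun x => ?_))
    (funext fun e => Subtype.ext (funext fun x => ?_))
  · exact (hc T x).trans (h0 T)
  · obtain ⟨_, T, hT, i, rfl⟩ := e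
    exact (hc' ⟨T, hT⟩ i x).trans (h0 _)

/-- Combine `h_T ≤ σ ρ` with `ρ h_T ≤ 2 |jac T|`. The maximum with one supplies a positive factor
for every real `σ`. -/
lemma diam_sq_le_of_shapeRegular {σ : ℝ} (hσ : 𝒯.ShapeRegular σ) (T : 𝒯.elements) :
    Metric.diam (carrier (T : Affine.Triangle ℝ Plane)) ^ 2 ≤
      2 * max σ 1 * |jac (T : Affine.Triangle ℝ Plane)| := by
  obtain ⟨c, r, hr, hball, hd⟩ := hσ T T.2
  have h1 := rho_mul_diam_le (T : Affine.Triangle ℝ Plane) hr hball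
  have hh := diam_pos (T : Affine.Triangle ℝ Plane)
  have h2 : Metric.diam (carrier (T : Affine.Triangle ℝ Plane)) ≤ max σ 1 * r :=
    hd.trans (mul_le_mul_of_nonneg_right (le_max_left _ _) hr.le)
  have h3 : 0 < max σ 1 := by positivity
  have h4 := mul_le_mul_of_nonneg_right h2 hh.le
  have h5 := mul_le_mul_of_nonneg_left h1 h3.le
  linarith

end Triangulation

end WG

end

/-! ### Summation over the elements and conclusion. -/

theorem lemma3p2 (k : ℕ) (hk : 1 ≤ k) :
    (∀ σ : ℝ, ∃ C₁ C₂ : ℝ, 0 < C₁ ∧ 0 < C₂ ∧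
      ∀ Ω : Set WG.Plane, IsOpen Ω → IsConnected Ω →
      ∀ 𝒯 : WG.Triangulation Ω, 𝒯.ShapeRegular σ →
      ∀ v : 𝒯.Vh k,
        C₁ * WG.Triangulation.discreteH1Norm v ≤ WG.Triangulation.energyNorm v ∧
        WG.Triangulation.energyNorm v ≤ C₂ * WG.Triangulation.discreteH1Norm v) ∧
    (∀ Ω : Set WG.Plane, IsOpen Ω → IsConnected Ω →
      ∀ 𝒯 : WG.Triangulation Ω,
        ∃ N : Seminorm ℝ (𝒯.Vh0 k),
          (∀ v : 𝒯.Vh0 k, N v = WG.Triangulation.energyNorm (v : 𝒯.Vh k)) ∧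
          ∀ v : 𝒯.Vh0 k, N v = 0 → v = 0) := by
  constructor
  · intro σ
    obtain ⟨C, hC, hloc⟩ := WG.exists_local_equivalence hk
    have hM : 0 < max σ 1 := by positivity
    -- The local constant `C K²` for `K = 2 max σ 1`. It compares squared norms in both directions,
    -- so the global constants are `(√D)⁻¹` and `√D`.
    set D : ℝ := C * (2 * max σ 1) ^ 2 with hD
    have hD0 : 0 < D := by positivity
    have hs : 0 < √D := Real.sqrt_pos.2 hD0
    refine ⟨(√D)⁻¹, √D, by positivity, hs, fun Ω _ _ 𝒯 hσ v => ?_⟩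
    have hT := fun T : 𝒯.elements => hloc _ T (v.1 T) (WG.Triangulation.boundaryPart v T)
      (WG.Triangulation.weakGrad v T) (WG.Triangulation.diam_sq_le_of_shapeRegular hσ T)
      (fun i => (v.2 (𝒯.edgeOf T i)).2) (WG.Triangulation.isWeakGradient_weakGrad v T)
    constructor
    · rw [inv_mul_le_iff₀ hs, WG.Triangulation.energyNorm, WG.Triangulation.discreteH1Norm,
        ← Real.sqrt_mul hD0.le, Finset.mul_sum]
      exact Real.sqrt_le_sqrt (Finset.sum_le_sum fun T _ => (hT T).2)
    · rw [WG.Triangulation.energyNorm, WG.Triangulation.discreteH1Norm,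
        ← Real.sqrt_mul hD0.le, Finset.mul_sum]
      exact Real.sqrt_le_sqrt (Finset.sum_le_sum fun T _ => (hT T).1)
  · intro Ω hΩ _ 𝒯
    obtain ⟨N, hN⟩ := WG.exists_seminorm_of_form (WG.Triangulation.energyForm 𝒯 k)
      (fun u v => by simp only [WG.Triangulation.energyForm_apply, mul_comm])
      (fun v => by
        rw [WG.Triangulation.energyForm_apply]
        exact Finset.sum_nonneg fun T _ => MeasureTheory.integral_nonneg fun x =>
          Finset.sum_nonneg fun j _ => mul_self_nonneg _)
    refine ⟨N.comp (𝒯.Vh0 k).subtype, fun v => ?_, fun v hv => ?_⟩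
    · rw [WG.Triangulation.energyNorm_eq]
      exact hN v
    · refine Subtype.ext (WG.Triangulation.eq_zero_of_energyNorm_eq_zero hk hΩ v.2 ?_)
      rw [WG.Triangulation.energyNorm_eq]
      exact (hN v).symm.trans hv
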